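/- A differential function of $z$ is a real-valued $C^\infty$ function of $t,x$ and finitely many of the jet coordinates $z_0=z,\ z_1=z_x,\ z_2=z_{xx},\dots$, defined for all real values of its arguments; put $\mathrm D_x=\partial_x+\sum_{k\ge0} z_{k+1}\partial_{z_k}$. For an evolution equation $z_t=L[z]$ put $\mathrm D_t=\partial_t+\sum_{k\ge 0}(\mathrm D_x^kL)\,\partial_{z_k}$. A generalized symmetry of this equation (in evolution form with reduced characteristic) is a generalized vector field $\eta\,\partial_z$, where $\eta$ is a differential function with $\mathrm D_t\eta=\sum_{k\ge0}\frac{\partial L}{\partial z_k}\mathrm D_x^k\eta$; it is identified with its prolongation $\sum_{k\ge0}(\mathrm D_x^k\eta)\,\partial_{z_k}$, and the Lie bracket is the commutator of prolongations. Let $\Sigma_2$ be the Lie algebra of generalized symmetries of the potential Burgers equation $w_t=w_{xx}+w_x^2$ and $\Sigma_3$ the Lie algebra of generalized symmetries of the Burgers equation $v_t+vv_x=v_{xx}$. Let $\tilde{\mathrm P}=\mathrm D_x+w_x$, $\tilde{\mathrm G}=t\tilde{\mathrm P}+\tfrac12x$, and let the essential algebra $\Lambda_2$ be the linear span of the generalized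 vector fields $(\tilde{\mathrm G}^k\tilde{\mathrm P}^l1)\,\partial_w$, $k,l\in\mathbb N_0$; it is closed under the Lie bracket. Then $\Lambda_2\subseteq\Sigma_2$, and there is a Lie algebra homomorphism $\varphi\colon\Lambda_2\to\Sigma_3$ induced by the differential substitution $v=-2w_x$, in the following sense: for $Q=\eta\,\partial_w\in\Lambda_2$ and $R=\xi\,\partial_v\in\Sigma_3$, one has $\varphi(Q)=R$ if and only if $-2\,\mathrm D_x\eta$ (the coefficient obtained by prolonging $Q$ to $-2w_x$) equals the differential function obtained from $\xi$ by substituting $v_k=-2w_{k+1}$, $k\ge0$. The homomorphism $\varphi$ is surjective, and its kernel is the linear span of $\partial_w$. -/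

import Mathlib

open scoped ContDiff

namespace BurgersSym

/-! ### Differential functions on the infinite-order jet space -/

/-- Coordinates `t, x, z₀ = z, z₁ = z_x, z₂ = z_xx, …` on the manifold that an evolution equation
`z_t = L[z]` for a function `z = z(t, x)` defines in the infinite-order jet space over
`ℝ²_{t,x} × ℝ_z`. -/
inductive Coord : Type
  | t : Coord
  | x : Coord
  | z : ℕ → Coord
  deriving DecidableEq

/-- Points of that manifold. -/
abbrev Jet : Type := Coord → ℝ

/-- `F` depends on the coordinates in the finite set `S` only, as the smooth function `g`. -/
def Represents (S : Finset Coord) (g : (S → ℝ) → ℝ) (F : Jet → ℝ) : Prop :=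
  ContDiff ℝ ∞ g ∧ ∀ p : Jet, F p = g (fun i => p i)

/-- A (reduced) differential function: a smooth function of finitely many of the coordinates. -/
def IsDiffFun (F : Jet → ℝ) : Prop :=
  ∃ (S : Finset Coord) (g : (S → ℝ) → ℝ), Represents S g F

theorem Represents.mono {S T : Finset Coord} {g : (S → ℝ) → ℝ} {F : Jet → ℝ}
    (h : Represents S g F) (hST : S ⊆ T) :
    Represents T (fun y => g (fun i => y ⟨i, hST i.2⟩)) F :=
  ⟨h.1.comp (by fun_prop), h.2⟩

theorem IsDiffFun.common {F G : Jet → ℝ} (hF : IsDiffFun F) (hG : IsDiffFun G) :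
    ∃ (S : Finset Coord) (f g : (S → ℝ) → ℝ), Represents S f F ∧ Represents S g G := by
  obtain ⟨S, f, hf⟩ := hF
  obtain ⟨T, g, hg⟩ := hG
  exact ⟨S ∪ T, _, _, hf.mono Finset.subset_union_left, hg.mono Finset.subset_union_right⟩

/-- The algebra of differential functions. -/
def DiffFun : Subalgebra ℝ (Jet → ℝ) where
  carrier := {F | IsDiffFun F}
  mul_mem' := by
    intro F G hF hG
    obtain ⟨S, f, g, hf, hg⟩ := IsDiffFun.common hF hG
    exact ⟨S, fun y => f y * g y, hf.1.mul hg.1, fun p => by simp [hf.2 p, hg.2 p]⟩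
  add_mem' := by
    intro F G hF hG
    obtain ⟨S, f, g, hf, hg⟩ := IsDiffFun.common hF hG
    exact ⟨S, fun y => f y + g y, hf.1.add hg.1, fun p => by simp [hf.2 p, hg.2 p]⟩
  algebraMap_mem' := by
    intro r
    exact ⟨∅, fun _ => r, contDiff_const, fun p => by simp [Pi.algebraMap_apply]⟩

/-- A coordinate as a differential function. -/
def coord (i : Coord) : DiffFun :=
  ⟨fun p => p i, {i}, fun y => y ⟨i, by simp⟩, by fun_prop, fun _ => rfl⟩

/-! ### Partial derivatives -/

/-- The partial derivative with respect to the coordinate `i`. -/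
noncomputable def pdFun (i : Coord) (F : Jet → ℝ) (p : Jet) : ℝ :=
  deriv (fun y => F (Function.update p i y)) (p i)

theorem Represents.hasDerivAt {S : Finset Coord} {g : (S → ℝ) → ℝ} {F : Jet → ℝ}
    (h : Represents S g F) {i : Coord} (hi : i ∈ S) (p : Jet) :
    HasDerivAt (fun y => F (Function.update p i y))
      (fderiv ℝ g (fun j => p j) (Pi.single ⟨i, hi⟩ 1)) (p i) := by
  have h1 : HasFDerivAt g (fderiv ℝ g (fun j : S => p j))
      (Function.update (fun j : S => p j) ⟨i, hi⟩ (p i)) := by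
    have e : Function.update (fun j : S => p j) ⟨i, hi⟩ (p i) = fun j : S => p j := by
      ext j
      by_cases hj : j = ⟨i, hi⟩
      · subst hj; simp
      · simp [Function.update_of_ne hj]
    rw [e]
    exact (h.1.differentiable (by simp)).differentiableAt.hasFDerivAt
  have h2 := h1.comp_hasDerivAt (p i) (hasDerivAt_update (fun j : S => p j) ⟨i, hi⟩ (p i))
  refine h2.congr_of_eventuallyEq (Filter.Eventually.of_forall fun y => ?_)
  simp only [h.2, Function.comp]
  congr 1
  ext j
  by_cases hj : j = ⟨i, hi⟩
  · subst hj; simp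
  · have : (j : Coord) ≠ i := fun hh => hj (Subtype.ext hh)
    simp [Function.update_of_ne hj, Function.update_of_ne this]

theorem Represents.pdFun {S : Finset Coord} {g : (S → ℝ) → ℝ} {F : Jet → ℝ}
    (h : Represents S g F) {i : Coord} (hi : i ∈ S) :
    Represents S (fun y => fderiv ℝ g y (Pi.single ⟨i, hi⟩ 1)) (pdFun i F) :=
  ⟨(h.1.fderiv_right (m := ∞) (by simp)).clm_apply contDiff_const,
    fun p => (h.hasDerivAt hi p).deriv⟩

theorem Represents.pdFun_eq_zero {S : Finset Coord} {g : (S → ℝ) → ℝ} {F : Jet → ℝ}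
    (h : Represents S g F) {i : Coord} (hi : i ∉ S) : BurgersSym.pdFun i F = 0 := by
  funext p
  have : (fun y => F (Function.update p i y)) = fun _ => F p := by
    funext y
    rw [h.2, h.2]
    congr 1
    ext j
    exact Function.update_of_ne (fun hh : (j : Coord) = i => hi (hh ▸ j.2)) _ _
  simp [BurgersSym.pdFun, this]

theorem IsDiffFun.hasDerivAt {F : Jet → ℝ} (hF : IsDiffFun F) (i : Coord) (p : Jet) :
    HasDerivAt (fun y => F (Function.update p i y)) (pdFun i F p) (p i) := by
  obtain ⟨S, g, h⟩ := hF
  have h' := (h.mono (Finset.subset_insert i S)).hasDerivAt (Finset.mem_insert_self i S) p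
  have e := h'.deriv
  unfold pdFun
  rw [e]
  exact h'

/-- The partial derivative as a linear map on differential functions. -/
noncomputable def pdLin (i : Coord) : DiffFun →ₗ[ℝ] DiffFun where
  toFun F := ⟨pdFun i F, by
    obtain ⟨S, g, h⟩ := F.2
    exact ⟨_, _, (h.mono (Finset.subset_insert i S)).pdFun (Finset.mem_insert_self i S)⟩⟩
  map_add' F G := by
    ext p
    exact ((IsDiffFun.hasDerivAt F.2 i p).add (IsDiffFun.hasDerivAt G.2 i p)).deriv
  map_smul' r F := by
    ext p
    exact ((IsDiffFun.hasDerivAt F.2 i p).const_mul r).deriv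

theorem pdLin_mul (i : Coord) (F G : DiffFun) :
    pdLin i (F * G) = F • pdLin i G + G • pdLin i F := by
  ext p
  have := ((IsDiffFun.hasDerivAt F.2 i p).mul (IsDiffFun.hasDerivAt G.2 i p)).deriv
  simp only [Function.update_eq_self] at this
  refine Eq.trans this ?_
  change pdFun i F p * (G : Jet → ℝ) p + (F : Jet → ℝ) p * pdFun i G p =
    (F : Jet → ℝ) p * pdFun i G p + (G : Jet → ℝ) p * pdFun i F p
  ring

/-- The partial derivative with respect to the coordinate `i`, as a derivation of the algebra of
differential functions. -/
noncomputable def pd (i : Coord) : Derivation ℝ DiffFun DiffFun :=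
  Derivation.mk' (pdLin i) (pdLin_mul i)

theorem pd_coord (i j : Coord) : pd i (coord j) = if i = j then 1 else 0 := by
  ext p
  change deriv (fun y => Function.update p i y j) (p i) = _
  by_cases h : i = j
  · subst h; simp
  · simp [h, Function.update_of_ne (Ne.symm h)]

theorem pd_comm (i j : Coord) (F : DiffFun) : pd i (pd j F) = pd j (pd i F) := by
  obtain ⟨S, g, h⟩ := F.2
  have h := h.mono (T := insert i (insert j S)) (fun a ha => by simp [ha])
  have hi : i ∈ insert i (insert j S) := by simp
  have hj : j ∈ insert i (insert j S) := by simp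
  obtain ⟨T, f, h, hi, hj⟩ : ∃ (T : Finset Coord) (f : (T → ℝ) → ℝ),
      Represents T f F ∧ i ∈ T ∧ j ∈ T := ⟨_, _, h, hi, hj⟩
  ext p
  have e1 := ((h.pdFun hj).pdFun hi).2 p
  have e2 := ((h.pdFun hi).pdFun hj).2 p
  change pdFun i (pdFun j F) p = pdFun j (pdFun i F) p
  rw [e1, e2]
  beta_reduce
  have hd : DifferentiableAt ℝ (fderiv ℝ f) (fun k : T => p k) :=
    ((h.1.fderiv_right (m := ∞) (by simp)).differentiable (by simp)).differentiableAt
  rw [fderiv_clm_apply hd (differentiableAt_const _),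
    fderiv_clm_apply hd (differentiableAt_const _)]
  have hs : IsSymmSndFDerivAt ℝ f (fun k : T => p k) :=
    (h.1.contDiffAt).isSymmSndFDerivAt (by
      rw [minSmoothness_of_isRCLikeNormedField]
      exact WithTop.coe_le_coe.2 (le_top : (2 : ℕ∞) ≤ ⊤))
  simpa using hs.eq _ _

theorem exists_finset (F : DiffFun) : ∃ S : Finset Coord, ∀ i ∉ S,
    pd i F = 0 ∧ ∀ j, pd i (pd j F) = 0 := by
  obtain ⟨S, g, h⟩ := F.2
  have h0 : ∀ i ∉ S, pd i F = 0 := fun i hi => Subtype.ext (h.pdFun_eq_zero hi)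
  exact ⟨S, fun i hi => ⟨h0 i hi, fun j => by rw [pd_comm, h0 i hi, map_zero]⟩⟩

/-! ### Vector fields on the jet space -/

theorem vf_support (c : Coord → DiffFun) (F : DiffFun) :
    (Function.support fun i => c i * pd i F).Finite := by
  obtain ⟨S, hS⟩ := exists_finset F
  refine S.finite_toSet.subset fun i hi => ?_
  by_contra hh
  exact hi (by simp [(hS i hh).1])

/-- The vector field `∑ᵢ cᵢ ∂ᵢ` on the jet space as a linear map. -/
noncomputable def vfLin (c : Coord → DiffFun) : DiffFun →ₗ[ℝ] DiffFun where
  toFun F := ∑ᶠ i, c i * pd i F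
  map_add' F G := by
    rw [← finsum_add_distrib (vf_support c F) (vf_support c G)]
    exact finsum_congr fun i => by rw [map_add, mul_add]
  map_smul' r F := by
    rw [RingHom.id_apply, smul_finsum]
    exact finsum_congr fun i => by rw [Derivation.map_smul, mul_smul_comm]

theorem vfLin_eq_sum (c : Coord → DiffFun) {F : DiffFun} {S : Finset Coord}
    (hS : ∀ i ∉ S, pd i F = 0) : vfLin c F = ∑ i ∈ S, c i * pd i F := by
  refine finsum_eq_sum_of_support_subset _ fun i hi => ?_
  by_contra hh
  refine hi ?_
  beta_reduce
  rw [hS i hh, mul_zero]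

theorem vfLin_mul (c : Coord → DiffFun) (F G : DiffFun) :
    vfLin c (F * G) = F • vfLin c G + G • vfLin c F := by
  obtain ⟨S, hS⟩ := exists_finset F
  obtain ⟨T, hT⟩ := exists_finset G
  have h1 : ∀ i ∉ S ∪ T, pd i F = 0 := fun i hi => (hS i fun h => hi (by simp [h])).1
  have h2 : ∀ i ∉ S ∪ T, pd i G = 0 := fun i hi => (hT i fun h => hi (by simp [h])).1
  have h3 : ∀ i ∉ S ∪ T, pd i (F * G) = 0 := fun i hi => by
    rw [Derivation.leibniz, h1 i hi, h2 i hi, smul_zero, smul_zero, add_zero]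
  rw [vfLin_eq_sum c h1, vfLin_eq_sum c h2, vfLin_eq_sum c h3, smul_eq_mul, smul_eq_mul,
    Finset.mul_sum, Finset.mul_sum, ← Finset.sum_add_distrib]
  refine Finset.sum_congr rfl fun i _ => ?_
  rw [Derivation.leibniz, smul_eq_mul, smul_eq_mul]
  ring

/-- The vector field `∑ᵢ cᵢ ∂ᵢ` on the jet space, the index `i` running through all coordinates
(only finitely many terms are nonzero on a given differential function). -/
noncomputable def vf (c : Coord → DiffFun) : Derivation ℝ DiffFun DiffFun :=
  Derivation.mk' (vfLin c) (vfLin_mul c)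

theorem vf_apply (c : Coord → DiffFun) (F : DiffFun) : vf c F = ∑ᶠ i, c i * pd i F := rfl

theorem vf_eq_sum (c : Coord → DiffFun) {F : DiffFun} {S : Finset Coord}
    (hS : ∀ i ∉ S, pd i F = 0) : vf c F = ∑ i ∈ S, c i * pd i F :=
  vfLin_eq_sum c hS

theorem vf_coord (c : Coord → DiffFun) (i : Coord) : vf c (coord i) = c i := by
  rw [vf_eq_sum c (S := {i})]
  · simp [pd_coord]
  · intro j hj
    simp only [Finset.mem_singleton] at hj
    simp [pd_coord, hj]

theorem lie_vf (c d : Coord → DiffFun) :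
    ⁅vf c, vf d⁆ = vf fun i => vf c (d i) - vf d (c i) := by
  ext1 F
  obtain ⟨S, hS⟩ := exists_finset F
  have key : ∀ a b : Coord → DiffFun, vf a (vf b F) =
      ∑ j ∈ S, vf a (b j) * pd j F + ∑ j ∈ S, ∑ i ∈ S, b j * (a i * pd i (pd j F)) := by
    intro a b
    rw [vf_eq_sum b (fun i hi => (hS i hi).1), map_sum, ← Finset.sum_add_distrib]
    refine Finset.sum_congr rfl fun j _ => ?_
    rw [Derivation.leibniz, vf_eq_sum a (F := pd j F) (fun i hi => (hS i hi).2 j), smul_eq_mul,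
      smul_eq_mul, Finset.mul_sum]
    ring
  rw [Derivation.commutator_apply, key, key, vf_eq_sum _ (fun i hi => (hS i hi).1)]
  have sw : ∑ j ∈ S, ∑ i ∈ S, d j * (c i * pd i (pd j F)) =
      ∑ j ∈ S, ∑ i ∈ S, c j * (d i * pd i (pd j F)) := by
    rw [Finset.sum_comm]
    refine Finset.sum_congr rfl fun i _ => Finset.sum_congr rfl fun j _ => ?_
    rw [pd_comm]
    ring
  rw [sw, add_sub_add_right_eq_sub, ← Finset.sum_sub_distrib]
  exact Finset.sum_congr rfl fun i _ => by ring

theorem vf_add (c d : Coord → DiffFun) : vf (c + d) = vf c + vf d := by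
  ext1 F
  obtain ⟨S, hS⟩ := exists_finset F
  have h := fun i hi => (hS i hi).1
  rw [Derivation.add_apply, vf_eq_sum _ h, vf_eq_sum _ h, vf_eq_sum _ h,
    ← Finset.sum_add_distrib]
  exact Finset.sum_congr rfl fun i _ => by rw [Pi.add_apply, add_mul]

theorem vf_smul (r : ℝ) (c : Coord → DiffFun) : vf (r • c) = r • vf c := by
  ext1 F
  obtain ⟨S, hS⟩ := exists_finset F
  have h := fun i hi => (hS i hi).1
  rw [Derivation.smul_apply, vf_eq_sum _ h, vf_eq_sum _ h, Finset.smul_sum]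
  exact Finset.sum_congr rfl fun i _ => by rw [Pi.smul_apply, smul_mul_assoc]

/-- The total derivative `D_x = ∂_x + ∑ₖ z_{k+1} ∂_{z_k}`. -/
noncomputable def Dx : Derivation ℝ DiffFun DiffFun :=
  vf fun
    | .t => 0
    | .x => 1
    | .z k => coord (.z (k + 1))

/-- The total derivative `D_t = ∂_t + ∑ₖ (D_x^k L) ∂_{z_k}` restricted to the equation
`z_t = L[z]`. -/
noncomputable def Dt (L : DiffFun) : Derivation ℝ DiffFun DiffFun :=
  vf fun
    | .t => 1
    | .x => 0
    | .z k => Dx^[k] L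

/-- The generalized vector field `η ∂_z` in evolution form with characteristic `η`, identified with
its infinite prolongation `∑ₖ (D_x^k η) ∂_{z_k}`. The Lie bracket of generalized vector fields is
the commutator of their prolongations. -/
noncomputable def evol (η : DiffFun) : Derivation ℝ DiffFun DiffFun :=
  vf fun
    | .t => 0
    | .x => 0
    | .z k => Dx^[k] η

theorem Dx_iterate_add (k : ℕ) (η χ : DiffFun) :
    Dx^[k] (η + χ) = Dx^[k] η + Dx^[k] χ := by
  induction k with
  | zero => rfl
  | succ k ih => simp only [Function.iterate_succ_apply', ih, map_add]

theorem Dx_iterate_smul (k : ℕ) (r : ℝ) (η : DiffFun) :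
    Dx^[k] (r • η) = r • Dx^[k] η := by
  induction k with
  | zero => rfl
  | succ k ih => simp only [Function.iterate_succ_apply', ih, Derivation.map_smul]

theorem evol_add (η χ : DiffFun) : evol (η + χ) = evol η + evol χ := by
  unfold evol
  rw [← vf_add]
  congr 1
  funext i
  cases i with
  | t => exact (add_zero _).symm
  | x => exact (add_zero _).symm
  | z k => exact Dx_iterate_add k η χ

theorem evol_smul (r : ℝ) (η : DiffFun) : evol (r • η) = r • evol η := by
  unfold evol
  rw [← vf_smul]
  congr 1
  funext i
  cases i <;> simp [Dx_iterate_smul]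

theorem evol_zero : evol 0 = 0 := by
  simpa using evol_smul 0 0

/-- The characteristic of `evol η` is `η`. -/
theorem evol_coord_z_zero (η : DiffFun) : evol η (coord (.z 0)) = η := by
  unfold evol
  rw [vf_coord]
  rfl

theorem vf_zero_of {c : Coord → DiffFun} (h : ∀ i, c i = 0) : vf c = 0 := by
  ext1 F
  rw [vf_apply]
  simp [h]

theorem lie_evol_Dx (η : DiffFun) : ⁅evol η, Dx⁆ = 0 := by
  have h := lie_vf (fun | .t => 0 | .x => 0 | .z k => Dx^[k] η)
    (fun | .t => 0 | .x => 1 | .z k => coord (.z (k + 1)))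
  refine Eq.trans h (vf_zero_of fun i => ?_)
  cases i with
  | t => simp
  | x => simp
  | z k =>
    change vf _ (coord (.z (k + 1))) - Dx (Dx^[k] η) = 0
    rw [vf_coord]
    simp only [Function.iterate_succ_apply', sub_self]

theorem evol_Dx (η F : DiffFun) : evol η (Dx F) = Dx (evol η F) := by
  have := congrArg (fun X => X F) (lie_evol_Dx η)
  simpa [Derivation.commutator_apply, sub_eq_zero] using this

theorem evol_Dx_iterate (η F : DiffFun) (k : ℕ) : evol η (Dx^[k] F) = Dx^[k] (evol η F) := by
  induction k with
  | zero => rfl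
  | succ k ih => rw [Function.iterate_succ_apply', Function.iterate_succ_apply', evol_Dx, ih]

theorem Dx_iterate_sub (k : ℕ) (η χ : DiffFun) :
    Dx^[k] (η - χ) = Dx^[k] η - Dx^[k] χ := by
  rw [eq_sub_iff_add_eq, ← Dx_iterate_add, sub_add_cancel]

theorem lie_evol (η χ : DiffFun) : ⁅evol η, evol χ⁆ = evol (evol η χ - evol χ η) := by
  have h := lie_vf (fun | .t => 0 | .x => 0 | .z k => Dx^[k] η)
    (fun | .t => 0 | .x => 0 | .z k => Dx^[k] χ)
  refine Eq.trans h ?_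
  unfold evol
  congr 1
  funext i
  cases i with
  | t => simp
  | x => simp
  | z k =>
    change evol η (Dx^[k] χ) - evol χ (Dx^[k] η) = Dx^[k] (evol η χ - evol χ η)
    rw [evol_Dx_iterate, evol_Dx_iterate, Dx_iterate_sub]

/-! ### Generalized symmetries of an evolution equation -/

/-- The generalized invariance condition: `η ∂_z` is a generalized symmetry of `z_t = L[z]` when its
prolongation annihilates `z_t - L[z]` on the equation, that is,
`D_t η = ∑ₖ (∂L/∂z_k) D_x^k η`. -/
def IsSymmetry (L η : DiffFun) : Prop :=
  Dt L η = evol η L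

theorem IsSymmetry.evol_Dt {L η : DiffFun} (h : IsSymmetry L η) (F : DiffFun) :
    evol η (Dt L F) = Dt L (evol η F) := by
  have hDxDt : ∀ G, Dx (Dt L G) = Dt L (Dx G) := by
    have h0 := lie_vf (fun | .t => 1 | .x => 0 | .z k => Dx^[k] L)
      (fun | .t => 0 | .x => 1 | .z k => coord (.z (k + 1)))
    have h1 : ⁅Dt L, Dx⁆ = 0 := by
      refine Eq.trans h0 (vf_zero_of fun i => ?_)
      cases i with
      | t => simp
      | x => simp
      | z k =>
        change vf _ (coord (.z (k + 1))) - Dx (Dx^[k] L) = 0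
        rw [vf_coord]
        simp only [Function.iterate_succ_apply', sub_self]
    intro G
    have := congrArg (fun X => X G) h1
    simp only [Derivation.commutator_apply, Derivation.zero_apply, sub_eq_zero] at this
    exact this.symm
  have hk : ∀ k G, Dt L (Dx^[k] G) = Dx^[k] (Dt L G) := by
    intro k G
    induction k with
    | zero => rfl
    | succ k ih => rw [Function.iterate_succ_apply', Function.iterate_succ_apply', ← hDxDt, ih]
  have h0 := lie_vf (fun | .t => 0 | .x => 0 | .z k => Dx^[k] η)
    (fun | .t => 1 | .x => 0 | .z k => Dx^[k] L)
  have h1 : ⁅evol η, Dt L⁆ = 0 := by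
    refine Eq.trans h0 (vf_zero_of fun i => ?_)
    cases i with
    | t => simp
    | x => simp
    | z k =>
      change evol η (Dx^[k] L) - Dt L (Dx^[k] η) = 0
      rw [evol_Dx_iterate, hk, h, sub_self]
  have := congrArg (fun X => X F) h1
  simpa [Derivation.commutator_apply, sub_eq_zero] using this

/-- The Lie algebra of generalized symmetries of the evolution equation `z_t = L[z]`
(canonical representatives: evolution form, reduced characteristics). -/
noncomputable def genSym (L : DiffFun) : LieSubalgebra ℝ (Derivation ℝ DiffFun DiffFun) where
  carrier := {X | ∃ η, IsSymmetry L η ∧ X = evol η}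
  zero_mem' := ⟨0, by simp [IsSymmetry, evol_zero], evol_zero.symm⟩
  add_mem' := by
    rintro _ _ ⟨η, hη, rfl⟩ ⟨χ, hχ, rfl⟩
    refine ⟨η + χ, ?_, (evol_add η χ).symm⟩
    rw [IsSymmetry, map_add, evol_add, Derivation.add_apply, hη, hχ]
  smul_mem' := by
    rintro r _ ⟨η, hη, rfl⟩
    refine ⟨r • η, ?_, (evol_smul r η).symm⟩
    rw [IsSymmetry, Derivation.map_smul, evol_smul, Derivation.smul_apply, hη]
  lie_mem' := by
    rintro _ _ ⟨η, hη, rfl⟩ ⟨χ, hχ, rfl⟩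
    refine ⟨evol η χ - evol χ η, ?_, lie_evol η χ⟩
    rw [IsSymmetry, ← lie_evol, Derivation.commutator_apply, map_sub, ← hη.evol_Dt, ← hχ.evol_Dt,
      hη, hχ]

/-! ### The potential Burgers equation and the Burgers equation -/

/-- The right-hand side `w_xx + w_x²` of the potential Burgers equation `w_t = w_xx + w_x²`. -/
noncomputable def potBurgersRHS : DiffFun := coord (.z 2) + coord (.z 1) ^ 2

/-- The right-hand side `v_xx - v v_x` of the Burgers equation `v_t + v v_x = v_xx`. -/
noncomputable def burgersRHS : DiffFun := coord (.z 2) - coord (.z 0) * coord (.z 1)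

/-- The algebra `Σ₂` of generalized symmetries of the potential Burgers equation. -/
noncomputable def Sigma2 : LieSubalgebra ℝ (Derivation ℝ DiffFun DiffFun) := genSym potBurgersRHS

/-- The algebra `Σ₃` of generalized symmetries of the Burgers equation. -/
noncomputable def Sigma3 : LieSubalgebra ℝ (Derivation ℝ DiffFun DiffFun) := genSym burgersRHS

/-- The recursion operator `P = D_x + w_x` of the potential Burgers equation. -/
noncomputable def opP : Module.End ℝ DiffFun :=
  Dx.toLinearMap + LinearMap.mulLeft ℝ (coord (.z 1))

/-- The recursion operator `G = t P + x / 2` of the potential Burgers equation. -/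
noncomputable def opG : Module.End ℝ DiffFun :=
  LinearMap.mulLeft ℝ (coord .t) * opP + (1 / 2 : ℝ) • LinearMap.mulLeft ℝ (coord .x)

/-- The generalized vector field `(G^k P^l 1) ∂_w`. -/
noncomputable def Qtilde (k l : ℕ) : Derivation ℝ DiffFun DiffFun :=
  evol ((opG ^ k * opP ^ l) 1)

theorem opP_apply (F : DiffFun) : opP F = Dx F + coord (.z 1) * F := rfl

theorem opG_apply (F : DiffFun) :
    opG F = coord .t * opP F + (1 / 2 : ℝ) • (coord .x * F) := rfl

theorem Dx_t : Dx (coord .t) = 0 := vf_coord _ _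

theorem Dx_x : Dx (coord .x) = 1 := vf_coord _ _

theorem opP_opG : opP * opG = opG * opP + (1 / 2 : ℝ) • 1 := by
  ext1 F
  change opP (opG F) = opG (opP F) + (1 / 2 : ℝ) • F
  rw [opG_apply, opG_apply, opP_apply (_ + _), map_add, Derivation.map_smul, Derivation.leibniz,
    Derivation.leibniz, Dx_t, Dx_x, opP_apply (opP F), opP_apply F]
  simp only [smul_eq_mul, mul_zero, add_zero, mul_one, mul_add, smul_add, mul_smul_comm]
  rw [mul_left_comm (coord .x) (coord (.z 1)) F,
    mul_left_comm (coord .t) (coord (.z 1))]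
  rw [map_add]
  ring_nf

/-- The span of the operators `G^k P^l`. -/
noncomputable def opSpan : Submodule ℝ (Module.End ℝ DiffFun) :=
  Submodule.span ℝ {T | ∃ k l : ℕ, T = opG ^ k * opP ^ l}

theorem opG_mul_mem {T : Module.End ℝ DiffFun} (hT : T ∈ opSpan) : opG * T ∈ opSpan := by
  refine Submodule.span_induction (p := fun T _ => opG * T ∈ opSpan) ?_ ?_ ?_ ?_ hT
  · rintro _ ⟨k, l, rfl⟩
    exact Submodule.subset_span ⟨k + 1, l, by rw [pow_succ', mul_assoc]⟩
  · simp
  · intro _ _ _ _ h1 h2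
    rw [mul_add]
    exact add_mem h1 h2
  · intro r _ _ h
    rw [mul_smul_comm]
    exact Submodule.smul_mem _ r h

theorem opP_mul_mem {T : Module.End ℝ DiffFun} (hT : T ∈ opSpan) : opP * T ∈ opSpan := by
  refine Submodule.span_induction (p := fun T _ => opP * T ∈ opSpan) ?_ ?_ ?_ ?_ hT
  · rintro _ ⟨k, l, rfl⟩
    induction k with
    | zero => exact Submodule.subset_span ⟨0, l + 1, by simp [pow_succ']⟩
    | succ k ih =>
      have e : opP * (opG ^ (k + 1) * opP ^ l) =
          opG * (opP * (opG ^ k * opP ^ l)) + (1 / 2 : ℝ) • (opG ^ k * opP ^ l) := by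
        rw [pow_succ', mul_assoc, ← mul_assoc opP, opP_opG, add_mul, mul_assoc, smul_mul_assoc,
          one_mul]
      rw [e]
      exact add_mem (opG_mul_mem ih) (Submodule.smul_mem _ _ (Submodule.subset_span ⟨k, l, rfl⟩))
  · simp
  · intro _ _ _ _ h1 h2
    rw [mul_add]
    exact add_mem h1 h2
  · intro r _ _ h
    rw [mul_smul_comm]
    exact Submodule.smul_mem _ r h

theorem mul_mem_opSpan (k l : ℕ) {T : Module.End ℝ DiffFun} (hT : T ∈ opSpan) :
    opG ^ k * opP ^ l * T ∈ opSpan := by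
  have hP : opP ^ l * T ∈ opSpan := by
    induction l with
    | zero => simpa using hT
    | succ l ih =>
      rw [pow_succ', mul_assoc]
      exact opP_mul_mem ih
  rw [mul_assoc]
  induction k with
  | zero => simpa using hP
  | succ k ih =>
    rw [pow_succ', mul_assoc]
    exact opG_mul_mem ih

theorem evol_opP (η F : DiffFun) :
    evol η (opP F) + η * opP F = opP (evol η F + η * F) := by
  have h1 : evol η (coord (.z 1)) = Dx η := vf_coord _ _
  rw [opP_apply, opP_apply, map_add, map_add, Derivation.leibniz, Derivation.leibniz, h1, evol_Dx]
  simp only [smul_eq_mul]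
  ring

theorem evol_opG (η F : DiffFun) :
    evol η (opG F) + η * opG F = opG (evol η F + η * F) := by
  have ht : evol η (coord .t) = 0 := vf_coord _ _
  have hx : evol η (coord .x) = 0 := vf_coord _ _
  rw [opG_apply, opG_apply, ← evol_opP, map_add, Derivation.map_smul, Derivation.leibniz,
    Derivation.leibniz, ht, hx]
  simp only [smul_eq_mul, mul_zero, add_zero, mul_add, smul_add, mul_smul_comm]
  rw [mul_left_comm η, mul_left_comm η]
  abel

theorem evol_ops (η : DiffFun) (k l : ℕ) :
    evol η ((opG ^ k * opP ^ l) 1) + η * (opG ^ k * opP ^ l) 1 = (opG ^ k * opP ^ l) η := by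
  have hP : evol η ((opP ^ l) 1) + η * (opP ^ l) 1 = (opP ^ l) η := by
    induction l with
    | zero => simp
    | succ l ih =>
      rw [pow_succ', Module.End.mul_apply, Module.End.mul_apply, evol_opP, ih]
  rw [Module.End.mul_apply, Module.End.mul_apply]
  induction k with
  | zero => simpa using hP
  | succ k ih =>
    rw [pow_succ', Module.End.mul_apply, Module.End.mul_apply, evol_opG, ih]

theorem evol_mem_span {T : Module.End ℝ DiffFun} (hT : T ∈ opSpan) :
    evol (T 1) ∈ Submodule.span ℝ {X | ∃ k l : ℕ, X = Qtilde k l} := by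
  refine Submodule.span_induction
    (p := fun T _ => evol (T 1) ∈ Submodule.span ℝ {X | ∃ k l : ℕ, X = Qtilde k l}) ?_ ?_ ?_ ?_ hT
  · rintro _ ⟨k, l, rfl⟩
    exact Submodule.subset_span ⟨k, l, rfl⟩
  · simp [evol_zero]
  · intro _ _ _ _ h1 h2
    rw [LinearMap.add_apply, evol_add]
    exact add_mem h1 h2
  · intro r _ _ h
    rw [LinearMap.smul_apply, evol_smul]
    exact Submodule.smul_mem _ r h

theorem lie_Qtilde (k l k' l' : ℕ) :
    ⁅Qtilde k l, Qtilde k' l'⁆ ∈ Submodule.span ℝ {X | ∃ k l : ℕ, X = Qtilde k l} := by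
  unfold Qtilde
  rw [lie_evol]
  have h1 := evol_ops ((opG ^ k * opP ^ l) 1) k' l'
  have h2 := evol_ops ((opG ^ k' * opP ^ l') 1) k l
  have e : evol ((opG ^ k * opP ^ l) 1) ((opG ^ k' * opP ^ l') 1) -
      evol ((opG ^ k' * opP ^ l') 1) ((opG ^ k * opP ^ l) 1) =
      (opG ^ k' * opP ^ l' * (opG ^ k * opP ^ l) +
        (-1 : ℝ) • (opG ^ k * opP ^ l * (opG ^ k' * opP ^ l'))) 1 := by
    rw [LinearMap.add_apply, LinearMap.smul_apply, Module.End.mul_apply (opG ^ k' * opP ^ l'),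
      Module.End.mul_apply (opG ^ k * opP ^ l), ← h1, ← h2, neg_one_smul]
    ring
  rw [e]
  exact evol_mem_span (Submodule.add_mem _
    (mul_mem_opSpan _ _ (Submodule.subset_span ⟨_, _, rfl⟩))
    (Submodule.smul_mem _ _ (mul_mem_opSpan _ _ (Submodule.subset_span ⟨_, _, rfl⟩))))

/-- The essential algebra `Λ₂` of generalized symmetries of the potential Burgers equation: the
linear span of the generalized vector fields `(G^k P^l 1) ∂_w`, `k, l ∈ ℕ`. -/
noncomputable def Lambda2 : LieSubalgebra ℝ (Derivation ℝ DiffFun DiffFun) where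
  toSubmodule := Submodule.span ℝ {X | ∃ k l : ℕ, X = Qtilde k l}
  lie_mem' := by
    intro X Y hX hY
    change X ∈ Submodule.span ℝ _ at hX
    change Y ∈ Submodule.span ℝ _ at hY
    change ⁅X, Y⁆ ∈ Submodule.span ℝ _
    refine Submodule.span_induction₂
      (p := fun X Y _ _ => ⁅X, Y⁆ ∈ Submodule.span ℝ {X | ∃ k l : ℕ, X = Qtilde k l})
      ?_ ?_ ?_ ?_ ?_ ?_ ?_ hX hY
    · rintro _ _ ⟨k, l, rfl⟩ ⟨k', l', rfl⟩
      exact lie_Qtilde k l k' l'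
    · intro Y _
      rw [show ⁅(0 : Derivation ℝ DiffFun DiffFun), Y⁆ = 0 from
        Derivation.ext fun F => by simp [Derivation.commutator_apply]]
      exact Submodule.zero_mem _
    · intro X _
      rw [show ⁅X, (0 : Derivation ℝ DiffFun DiffFun)⁆ = 0 from
        Derivation.ext fun F => by simp [Derivation.commutator_apply]]
      exact Submodule.zero_mem _
    · intro X Y Z _ _ _ h1 h2
      rw [show ⁅X + Y, Z⁆ = ⁅X, Z⁆ + ⁅Y, Z⁆ from add_lie X Y Z]
      exact Submodule.add_mem _ h1 h2
    · intro X Y Z _ _ _ h1 h2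
      rw [show ⁅X, Y + Z⁆ = ⁅X, Y⁆ + ⁅X, Z⁆ from lie_add X Y Z]
      exact Submodule.add_mem _ h1 h2
    · intro r X Y _ _ h
      rw [show ⁅r • X, Y⁆ = r • ⁅X, Y⁆ from smul_lie r X Y]
      exact Submodule.smul_mem _ r h
    · intro r X Y _ _ h
      rw [show ⁅X, r • Y⁆ = r • ⁅X, Y⁆ from lie_smul r X Y]
      exact Submodule.smul_mem _ r h

/-- The generalized vector field `∂_w`. -/
noncomputable def partialW : Derivation ℝ DiffFun DiffFun := evol 1

theorem partialW_mem : partialW ∈ Lambda2 :=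
  Submodule.subset_span ⟨0, 0, by simp [partialW, Qtilde]⟩

/-- The differential substitution `v = -2 w_x` together with its differential consequences
`v_k = -2 w_{k+1}`, as a map from the jets of `w` to the jets of `v`. -/
def subst (p : Jet) : Jet
  | .t => p .t
  | .x => p .x
  | .z k => -2 * p (.z (k + 1))

/-- The generalized vector field `R` in the jets of `v` is induced by the generalized vector field
`Q` in the jets of `w` through `v = -2 w_x`: the coefficient `Q (-2 w_x)` obtained by prolonging `Q`
to `w_x` depends on `t, x, w_x, w_xx, …` only, and it turns into the characteristic `R v` of `R`
when each derivative `w_{k+1}` is replaced by `-v_k / 2`. -/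
def InducedBy (Q R : Derivation ℝ DiffFun DiffFun) : Prop :=
  ∀ p : Jet, (Q ((-2 : ℝ) • coord (.z 1)) : Jet → ℝ) p = (R (coord (.z 0)) : Jet → ℝ) (subst p)

end BurgersSym

/-!
Under `u = e^w` the potential Burgers equation becomes the heat equation, and `P`, `G` become the
operators `D_x` and `t D_x + x / 2`. A characteristic `η` is a symmetry if and only if it is
annihilated by `D_t + (w_xx + w_x²) - P²`, which is the heat operator conjugated by `e^w`; this
operator commutes with `P` and `G` and annihilates `1`, so the essential algebra consists of
symmetries (`Lambda2_le_Sigma2`).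

The substitution `v = -2 w_x` gives an injective homomorphism `substHom` of algebras of
differential functions, which intertwines the total derivatives (`Dx_substHom`, `Dt_substHom`) and
whose image contains all functions that do not involve `w` itself. The characteristics in the
essential algebra do not involve `w`, so each `η ∂_w` induces a unique `ξ ∂_v`, whose prolongation
is related to that of `η ∂_w` by `substHom` (`evol_substHom`). Relatedness respects brackets and
carries symmetries to symmetries, which yields the homomorphism `inducedHom`.

Surjectivity requires all symmetries `F` of the Burgers equation, by induction on the order `n`.
Comparing coefficients of `v_{n+1}` in the invariance condition gives `D_x (∂F/∂v_n) = 0`, so the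
leading coefficient is a function `a(t)` (`timeOnly_leading_of_isSymmetry`). There is no nonzero
symmetry of order zero, and one of order one is `a v_1 - a'` with `a'' = 0`. For `n ≥ 2` the
coefficient of `v_n` shows that `∂_x F`, again a symmetry, has order at most `n - 1` and leading
coefficient `a' / 2` (`pd_t_leading_of_isSymmetry`); hence `a` is a polynomial of degree at most `n`
(`leading_mem_timePoly`). Since `G^k P^(n-k) 1` induces a symmetry with leading term `t^k v_n`, the
order of `F` drops after subtracting a suitable induced symmetry (`exists_inducedChar_eq`).

An element `η ∂_w` of the kernel has `D_x η = 0`, so `η` depends on `t` only, and the invariance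
condition makes it constant (`ker_inducedHom`).
-/

namespace BurgersSym

/-! ### Commutation of partial and total derivatives -/

theorem pd_eq_vf (i : Coord) (F : DiffFun) : pd i F = vf (Pi.single i 1) F := by
  rw [vf_apply, finsum_eq_single _ i]
  · simp
  · intro j hj
    simp [Pi.single_eq_of_ne hj]

/-- The commutator of `∂_i` with a vector field: `∂_i` acts on the coefficients. -/
theorem pd_vf (i : Coord) (c : Coord → DiffFun) (F : DiffFun) :
    pd i (vf c F) = vf c (pd i F) + vf (fun j => pd i (c j)) F := by
  have h := congrArg (fun X => X F) (lie_vf (Pi.single i 1) c)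
  have e : (fun j => vf (Pi.single i 1) (c j) - vf c ((Pi.single i 1 : Coord → DiffFun) j)) =
      fun j => pd i (c j) := by
    funext j
    have : vf c ((Pi.single i 1 : Coord → DiffFun) j) = 0 := by
      rcases eq_or_ne j i with rfl | hj
      · simp
      · simp [Pi.single_eq_of_ne hj]
    rw [this, sub_zero, pd_eq_vf]
  rw [e] at h
  simp only [Derivation.commutator_apply, ← pd_eq_vf] at h
  rw [← h]
  ring

/-- A vector field evaluated by a finite sum over any set of coordinates outside which all the
terms vanish. -/
theorem vf_eq_sum_of_mul (c : Coord → DiffFun) {F : DiffFun} (S : Finset Coord)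
    (hS : ∀ i ∉ S, c i * pd i F = 0) : vf c F = ∑ i ∈ S, c i * pd i F :=
  finsum_eq_sum_of_support_subset _ fun i hi => by
    by_contra hh
    exact hi (hS i hh)

theorem pd_Dx_of_ne {i : Coord} (hi : ∀ k, i ≠ .z (k + 1)) (F : DiffFun) :
    pd i (Dx F) = Dx (pd i F) := by
  refine (pd_vf _ _ _).trans (add_eq_left.2 (DFunLike.congr_fun (vf_zero_of ?_) F))
  rintro (_ | _ | k)
  · exact map_zero _
  · exact Derivation.map_one_eq_zero _
  · exact (pd_coord _ _).trans (if_neg (hi k))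

theorem pd_z_zero_Dx (F : DiffFun) : pd (.z 0) (Dx F) = Dx (pd (.z 0) F) :=
  pd_Dx_of_ne (by simp) F

theorem pd_z_succ_Dx (k : ℕ) (F : DiffFun) :
    pd (.z (k + 1)) (Dx F) = Dx (pd (.z (k + 1)) F) + pd (.z k) F := by
  refine (pd_vf _ _ _).trans (congrArg₂ _ rfl ?_)
  rw [vf_eq_sum_of_mul _ {.z k}]
  · simp [pd_coord]
  · rintro (_ | _ | j) hj <;> simp_all [pd_coord, eq_comm]

theorem Dx_z (k : ℕ) : Dx (coord (.z k)) = coord (.z (k + 1)) := vf_coord _ _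

theorem Dt_t (L : DiffFun) : Dt L (coord .t) = 1 := vf_coord _ _

theorem Dt_x (L : DiffFun) : Dt L (coord .x) = 0 := vf_coord _ _

theorem Dt_z (L : DiffFun) (k : ℕ) : Dt L (coord (.z k)) = Dx^[k] L := vf_coord _ _

theorem evol_z (η : DiffFun) (k : ℕ) : evol η (coord (.z k)) = Dx^[k] η := vf_coord _ _

theorem Dx_Dt (L F : DiffFun) : Dx (Dt L F) = Dt L (Dx F) := by
  have h0 := lie_vf (fun | .t => 1 | .x => 0 | .z k => Dx^[k] L)
    (fun | .t => 0 | .x => 1 | .z k => coord (.z (k + 1)))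
  have h1 : ⁅Dt L, Dx⁆ = 0 := by
    refine Eq.trans h0 (vf_zero_of fun i => ?_)
    cases i with
    | t => simp
    | x => simp
    | z k =>
      change vf _ (coord (.z (k + 1))) - Dx (Dx^[k] L) = 0
      rw [vf_coord]
      simp only [Function.iterate_succ_apply', sub_self]
  have := congrArg (fun X => X F) h1
  simp only [Derivation.commutator_apply, Derivation.zero_apply, sub_eq_zero] at this
  exact this.symm

/-! ### Differential functions with vanishing partial derivatives -/

theorem pd_apply (i : Coord) (F : DiffFun) (p : Jet) :
    (pd i F : Jet → ℝ) p = pdFun i F p := rfl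

/-- A differential function whose derivative with respect to one coordinate vanishes does not
depend on that coordinate. -/
theorem apply_update_of_pd_eq_zero {i : Coord} {F : DiffFun} (h : pd i F = 0) (p : Jet) (y : ℝ) :
    (F : Jet → ℝ) (Function.update p i y) = (F : Jet → ℝ) p := by
  have hd : ∀ s, HasDerivAt (fun y => (F : Jet → ℝ) (Function.update p i y)) 0 s := by
    intro s
    have := IsDiffFun.hasDerivAt F.2 i (Function.update p i s)
    rw [← pd_apply, h] at this
    simpa using this
  have := is_const_of_deriv_eq_zero (fun s => (hd s).differentiableAt) (fun s => (hd s).deriv)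
    y (p i)
  simpa using this

theorem eq_algebraMap_of_pd_eq_zero {F : DiffFun} (h : ∀ i, pd i F = 0) :
    ∃ r : ℝ, F = algebraMap ℝ DiffFun r := by
  obtain ⟨S, g, hg⟩ := F.2
  have hz : ∀ y, fderiv ℝ g y = 0 := by
    intro y
    obtain ⟨p, rfl⟩ : ∃ p : Jet, (fun j : S => p j) = y :=
      ⟨fun i => if hi : i ∈ S then y ⟨i, hi⟩ else 0, by ext j; simp⟩
    refine ContinuousLinearMap.coe_injective (LinearMap.pi_ext' fun i => LinearMap.ext_ring ?_)
    have e := (hg.pdFun i.2).2 p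
    rw [← pd_apply, h] at e
    exact e.symm
  refine ⟨g 0, ?_⟩
  ext p
  rw [hg.2]
  exact is_const_of_fderiv_eq_zero (hg.1.differentiable (by simp)) hz _ _

/-- `F` does not involve the jet coordinates `z_j` with `j > n`. -/
def OrderLE (n : ℕ) (F : DiffFun) : Prop := ∀ j, n < j → pd (.z j) F = 0

/-- `F` is a function of `t` alone. -/
def TimeOnly (F : DiffFun) : Prop := ∀ i, i ≠ .t → pd i F = 0

theorem exists_orderLE (F : DiffFun) : ∃ n, OrderLE n F := by
  obtain ⟨S, hS⟩ := exists_finset F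
  have hinj : Function.Injective Coord.z := fun a b h => by injection h
  obtain ⟨n, hn⟩ := (S.preimage Coord.z hinj.injOn).bddAbove
  refine ⟨n, fun j hj => (hS _ fun h => ?_).1⟩
  exact absurd (hn (by simpa using h)) (not_le.2 hj)

theorem OrderLE.pd {n : ℕ} {F : DiffFun} (h : OrderLE n F) (i : Coord) : OrderLE n (pd i F) := by
  intro j hj
  rw [pd_comm, h j hj, map_zero]

/-- The kernel of the total derivative `D_x` consists of the functions of `t`. -/
theorem timeOnly_of_Dx_eq_zero {F : DiffFun} (h : Dx F = 0) : TimeOnly F := by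
  obtain ⟨n, hn⟩ := exists_orderLE F
  -- Descending induction on the order: the coefficient of `z_{j+1}` in `D_x F` is `∂F/∂z_j`, up to
  -- `D_x (∂F/∂z_{j+1})`, which vanishes by the previous step.
  have key : ∀ m ≤ n + 1, ∀ j, n + 1 - m ≤ j → pd (.z j) F = 0 := by
    intro m
    induction m with
    | zero => exact fun _ j hj => hn j (by omega)
    | succ m ih =>
      intro hm j hj
      have e := pd_z_succ_Dx j F
      rw [ih (by omega) (j + 1) (by omega), h, map_zero, map_zero, zero_add] at e
      exact e.symm
  have hz : ∀ j, pd (.z j) F = 0 := fun j => key (n + 1) le_rfl j (by omega)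
  rintro (_ | _ | j) hi
  · exact absurd rfl hi
  · have : Dx F = pd .x F := by
      unfold Dx
      rw [vf_eq_sum_of_mul _ {.x}]
      · simp
      · rintro (_ | _ | j) hj <;> simp_all
    rw [← this, h]
  · exact hz j

theorem TimeOnly.Dx_eq_zero {F : DiffFun} (h : TimeOnly F) : Dx F = 0 := by
  unfold Dx
  rw [vf_eq_sum_of_mul _ {.t}]
  · simp
  · exact fun i hi => by rw [h i (by simpa using hi), mul_zero]

theorem TimeOnly.Dt_eq {F : DiffFun} (h : TimeOnly F) (L : DiffFun) : Dt L F = pd .t F := by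
  unfold Dt
  rw [vf_eq_sum_of_mul _ {.t}]
  · simp
  · exact fun i hi => by rw [h i (by simpa using hi), mul_zero]

theorem TimeOnly.pd_t {F : DiffFun} (h : TimeOnly F) : TimeOnly (pd .t F) := by
  intro i hi
  rw [pd_comm, h i hi, map_zero]

/-! ### Polynomials in `t` -/

/-- The polynomials in `t` of degree at most `n`, as differential functions. -/
noncomputable def timePoly (n : ℕ) : Submodule ℝ DiffFun :=
  Submodule.span ℝ ((fun k : ℕ => coord .t ^ k) '' Set.Iic n)

theorem one_mem_timePoly (n : ℕ) : (1 : DiffFun) ∈ timePoly n :=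
  Submodule.subset_span ⟨0, Nat.zero_le n, pow_zero _⟩

theorem timeOnly_of_mem_timePoly {n : ℕ} {F : DiffFun} (h : F ∈ timePoly n) : TimeOnly F := by
  intro i hi
  refine Submodule.span_induction (p := fun F _ => pd i F = 0) ?_ (map_zero _) ?_ ?_ h
  · rintro _ ⟨k, -, rfl⟩
    simp [Derivation.leibniz_pow, pd_coord, hi]
  · intro _ _ _ _ h1 h2
    rw [map_add, h1, h2, add_zero]
  · intro r _ _ h1
    rw [Derivation.map_smul, h1, smul_zero]

theorem exists_primitive_mem_timePoly {n : ℕ} {F : DiffFun} (h : F ∈ timePoly n) :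
    ∃ G ∈ timePoly (n + 1), pd .t G = F := by
  suffices h' : timePoly n ≤ (timePoly (n + 1)).map (pd .t).toLinearMap from h' h
  refine Submodule.span_le.2 ?_
  rintro _ ⟨k, hk, rfl⟩
  refine ⟨((k : ℝ) + 1)⁻¹ • coord .t ^ (k + 1), Submodule.smul_mem _ _
    (Submodule.subset_span ⟨k + 1, Nat.succ_le_succ hk, rfl⟩), ?_⟩
  change pd .t (_ • _) = _
  have hk0 : (k : ℝ) + 1 ≠ 0 := by positivity
  rw [Derivation.map_smul, Derivation.leibniz_pow, pd_coord, if_pos rfl, Nat.add_sub_cancel,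
    ← Nat.cast_smul_eq_nsmul ℝ, smul_smul, Nat.cast_succ, inv_mul_cancel₀ hk0, one_smul,
    smul_eq_mul, mul_one]

theorem mem_timePoly_of_pd {n : ℕ} {F : DiffFun} (hF : TimeOnly F) (h : pd .t F ∈ timePoly n) :
    F ∈ timePoly (n + 1) := by
  obtain ⟨G, hG, e⟩ := exists_primitive_mem_timePoly h
  have hz : ∀ i, pd i (F - G) = 0 := by
    intro i
    rw [map_sub]
    by_cases hi : i = .t
    · subst hi; rw [e, sub_self]
    · rw [hF i hi, timeOnly_of_mem_timePoly hG i hi, sub_self]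
  obtain ⟨r, hr⟩ := eq_algebraMap_of_pd_eq_zero hz
  rw [eq_add_of_sub_eq hr, Algebra.algebraMap_eq_smul_one]
  exact add_mem (Submodule.smul_mem _ _ (one_mem_timePoly _)) hG


/-! ### Pullbacks along monomial maps of the jet space -/

/-- The map of the jet space that replaces the coordinate `i` by `c i` times the coordinate `σ i`. -/
def monomialMap (σ : Coord → Coord) (c : Coord → ℝ) (p : Jet) : Jet := fun i => c i * p (σ i)

theorem IsDiffFun.comp_monomialMap {F : Jet → ℝ} (hF : IsDiffFun F) (σ : Coord → Coord)
    (c : Coord → ℝ) : IsDiffFun (F ∘ monomialMap σ c) := by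
  obtain ⟨S, g, hg⟩ := hF
  refine ⟨S.image σ, fun y => g fun i => c i * y ⟨σ i, Finset.mem_image_of_mem σ i.2⟩,
    hg.1.comp (by fun_prop), fun p => hg.2 _⟩

/-- The pullback of differential functions along `monomialMap σ c`. -/
def pullback (σ : Coord → Coord) (c : Coord → ℝ) : DiffFun →ₐ[ℝ] DiffFun where
  toFun F := ⟨(F : Jet → ℝ) ∘ monomialMap σ c, F.2.comp_monomialMap σ c⟩
  map_one' := rfl
  map_mul' _ _ := rfl
  map_zero' := rfl
  map_add' _ _ := rfl
  commutes' _ := rfl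

/-- The substitution `v_k = -2 w_{k+1}` as a homomorphism from the differential functions of `v` to
those of `w`. -/
def substHom : DiffFun →ₐ[ℝ] DiffFun :=
  pullback (fun | .t => .t | .x => .x | .z k => .z (k + 1))
    (fun | .t => 1 | .x => 1 | .z _ => -2)

/-- The substitution `w_{k+1} = -v_k / 2`, `w = 0`: a one-sided inverse of `substHom`. -/
noncomputable def unsubstHom : DiffFun →ₐ[ℝ] DiffFun :=
  pullback (fun | .t => .t | .x => .x | .z k => .z (k - 1))
    (fun | .t => 1 | .x => 1 | .z 0 => 0 | .z (_ + 1) => -1 / 2)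

theorem substHom_apply (F : DiffFun) (p : Jet) :
    (substHom F : Jet → ℝ) p = (F : Jet → ℝ) (subst p) := by
  change (F : Jet → ℝ) _ = _
  refine congrArg (F : Jet → ℝ) (funext fun i => ?_)
  rcases i with _ | _ | k
  · exact one_mul _
  · exact one_mul _
  · rfl

/-- The differential functions that do not involve `w` itself are those that can be expressed
through `v = -2 w_x`. -/
theorem substHom_unsubstHom {F : DiffFun} (h : pd (.z 0) F = 0) :
    substHom (unsubstHom F) = F := by
  ext p
  rw [substHom_apply, ← apply_update_of_pd_eq_zero h p 0]
  change (F : Jet → ℝ) _ = _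
  refine congrArg (F : Jet → ℝ) (funext fun i => ?_)
  rcases i with _ | _ | _ | k
  · simp [monomialMap, subst]
  · simp [monomialMap, subst]
  · simp [monomialMap]
  · simp [monomialMap, subst]
    ring

theorem unsubstHom_substHom (F : DiffFun) : unsubstHom (substHom F) = F := by
  ext p
  change (substHom F : Jet → ℝ) _ = _
  rw [substHom_apply]
  refine congrArg (F : Jet → ℝ) (funext fun i => ?_)
  rcases i with _ | _ | k
  · simp [monomialMap, subst]
  · simp [monomialMap, subst]
  · simp [monomialMap, subst]
    ring

theorem substHom_injective : Function.Injective substHom :=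
  Function.LeftInverse.injective unsubstHom_substHom

theorem substHom_t : substHom (coord .t) = coord .t := by
  ext p
  rw [substHom_apply]
  rfl

theorem substHom_x : substHom (coord .x) = coord .x := by
  ext p
  rw [substHom_apply]
  rfl

theorem substHom_z (k : ℕ) : substHom (coord (.z k)) = (-2 : ℝ) • coord (.z (k + 1)) := by
  ext p
  rw [substHom_apply]
  rfl

theorem pd_substHom_apply (i : Coord) (F : DiffFun) (p : Jet) :
    (pd i (substHom F) : Jet → ℝ) p = deriv
      (fun y => (F : Jet → ℝ) (subst (Function.update p i y))) (p i) := by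
  change deriv _ _ = _
  simp only [substHom_apply]

theorem pd_t_substHom (F : DiffFun) : pd .t (substHom F) = substHom (pd .t F) := by
  ext p
  rw [pd_substHom_apply, substHom_apply]
  have : ∀ y, subst (Function.update p .t y) = Function.update (subst p) .t y := by
    intro y; funext i
    rcases i with _ | _ | k <;> simp [subst]
  simp only [this]
  rfl

theorem pd_x_substHom (F : DiffFun) : pd .x (substHom F) = substHom (pd .x F) := by
  ext p
  rw [pd_substHom_apply, substHom_apply]
  have : ∀ y, subst (Function.update p .x y) = Function.update (subst p) .x y := by
    intro y; funext i
    rcases i with _ | _ | k <;> simp [subst]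
  simp only [this]
  rfl

theorem pd_z_zero_substHom (F : DiffFun) : pd (.z 0) (substHom F) = 0 := by
  ext p
  rw [pd_substHom_apply]
  have : ∀ y, subst (Function.update p (.z 0) y) = subst p := by
    intro y; funext i
    rcases i with _ | _ | k <;> simp [subst]
  simp only [this]
  exact deriv_const _ _

theorem pd_z_succ_substHom (k : ℕ) (F : DiffFun) :
    pd (.z (k + 1)) (substHom F) = (-2 : ℝ) • substHom (pd (.z k) F) := by
  ext p
  rw [pd_substHom_apply]
  change _ = (-2 : ℝ) * _
  rw [substHom_apply]
  have : ∀ y, subst (Function.update p (.z (k + 1)) y) =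
      Function.update (subst p) (.z k) (-2 * y) := by
    intro y; funext i
    rcases i with _ | _ | j
    · simp [subst]
    · simp [subst]
    · by_cases hj : j = k
      · subst hj; simp [BurgersSym.subst]
      · simp [BurgersSym.subst, hj]
  simp only [this]
  have h1 : HasDerivAt (fun y => (F : Jet → ℝ) (Function.update (subst p) (.z k) y))
      ((pd (.z k) F : Jet → ℝ) (subst p)) (-2 * p (.z (k + 1))) :=
    IsDiffFun.hasDerivAt F.2 (.z k) (subst p)
  have h2 : HasDerivAt (fun y : ℝ => -2 * y) (-2) (p (.z (k + 1))) := by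
    simpa using (hasDerivAt_id (p (.z (k + 1)))).const_mul (-2)
  exact (h1.comp _ h2).deriv.trans (mul_comm _ _)

/-- Vector fields on the jet spaces of `w` and of `v` that are related on coordinates through
`v_k = -2 w_{k+1}` are related on all differential functions. -/
theorem vf_substHom {c d : Coord → DiffFun}
    (h : ∀ i, vf c (substHom (coord i)) = substHom (d i)) (F : DiffFun) :
    vf c (substHom F) = substHom (vf d F) := by
  have ht : c .t = substHom (d .t) := by rw [← h, substHom_t, vf_coord]
  have hx : c .x = substHom (d .x) := by rw [← h, substHom_x, vf_coord]
  have hz : ∀ k, (-2 : ℝ) • c (.z (k + 1)) = substHom (d (.z k)) := fun k => by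
    rw [← h, substHom_z, Derivation.map_smul, vf_coord]
  obtain ⟨n, hn⟩ := exists_orderLE F
  have inj : Function.Injective Coord.z := fun a b h => by injection h
  have hd : ∀ (e : Coord → DiffFun) (G : DiffFun) (N : ℕ), OrderLE N G →
      vf e G = e .t * pd .t G + (e .x * pd .x G +
        ∑ k ∈ Finset.range (N + 1), e (.z k) * pd (.z k) G) := by
    intro e G N hG
    rw [vf_eq_sum e (S := insert .t (insert .x ((Finset.range (N + 1)).map ⟨Coord.z, inj⟩))),
      Finset.sum_insert (by simp), Finset.sum_insert (by simp), Finset.sum_map]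
    · rfl
    · rintro (_ | _ | k) hk
      · simp at hk
      · simp at hk
      · exact hG k (by simp at hk; omega)
  have hn' : OrderLE (n + 1) (substHom F) := by
    rintro (_ | j) hj
    · omega
    · rw [pd_z_succ_substHom, hn j (by omega), map_zero, smul_zero]
  rw [hd c _ _ hn', hd d _ _ hn, Finset.sum_range_succ', pd_z_zero_substHom, pd_t_substHom,
    pd_x_substHom, ht, hx]
  simp only [map_add, map_mul, map_sum, ← hz, pd_z_succ_substHom, mul_zero, add_zero,
    mul_smul_comm, smul_mul_assoc]

theorem Dx_substHom (F : DiffFun) : Dx (substHom F) = substHom (Dx F) := by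
  refine vf_substHom (fun i => ?_) F
  change Dx _ = _
  rcases i with _ | _ | k
  · rw [substHom_t, Dx_t, map_zero]
  · rw [substHom_x, Dx_x, map_one]
  · rw [substHom_z, Derivation.map_smul, Dx_z, substHom_z]

theorem Dx_iterate_substHom (k : ℕ) (F : DiffFun) :
    Dx^[k] (substHom F) = substHom (Dx^[k] F) := by
  induction k with
  | zero => rfl
  | succ k ih => rw [Function.iterate_succ_apply', Function.iterate_succ_apply', ih, Dx_substHom]

/-- The prolongations of `η ∂_w` and `ξ ∂_v` are related by `v = -2 w_x` when their values at
`-2 w_x` and `v` are. -/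
theorem evol_substHom {η ξ : DiffFun} (h : (-2 : ℝ) • Dx η = substHom ξ) (F : DiffFun) :
    evol η (substHom F) = substHom (evol ξ F) := by
  refine vf_substHom (fun i => ?_) F
  change evol η _ = _
  rcases i with _ | _ | k
  · rw [substHom_t]
    exact (vf_coord _ _).trans (map_zero _).symm
  · rw [substHom_x]
    exact (vf_coord _ _).trans (map_zero _).symm
  · rw [substHom_z, Derivation.map_smul, evol_z, ← Dx_iterate_substHom, ← h, Dx_iterate_smul,
      Function.iterate_succ_apply]

/-- The substitution `v = -2 w_x` maps solutions of the potential Burgers equation to solutions of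
the Burgers equation. -/
theorem substHom_burgersRHS : substHom burgersRHS = (-2 : ℝ) • Dx potBurgersRHS := by
  unfold burgersRHS potBurgersRHS
  rw [map_sub, map_mul, substHom_z, substHom_z, substHom_z, map_add, Derivation.leibniz_pow, Dx_z,
    Dx_z]
  simp only [smul_eq_mul, pow_one, Nat.add_one_sub_one, Algebra.smul_def, map_neg, map_ofNat]
  push_cast
  ring

theorem Dt_substHom (F : DiffFun) :
    Dt potBurgersRHS (substHom F) = substHom (Dt burgersRHS F) := by
  refine vf_substHom (fun i => ?_) F
  change Dt _ _ = _
  rcases i with _ | _ | k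
  · rw [substHom_t, Dt_t, map_one]
  · rw [substHom_x, Dt_x, map_zero]
  · rw [substHom_z, Derivation.map_smul, Dt_z, ← Dx_iterate_substHom, substHom_burgersRHS,
      Dx_iterate_smul, Function.iterate_succ_apply]

/-- A symmetry of the potential Burgers equation induces a symmetry of the Burgers equation. -/
theorem IsSymmetry.of_substHom {η ξ : DiffFun} (hη : IsSymmetry potBurgersRHS η)
    (h : (-2 : ℝ) • Dx η = substHom ξ) : IsSymmetry burgersRHS ξ := by
  refine substHom_injective ?_
  rw [← Dt_substHom, ← evol_substHom h, ← h, substHom_burgersRHS, Derivation.map_smul,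
    Derivation.map_smul, ← Dx_Dt, evol_Dx, hη]


/-! ### Symmetries of the potential Burgers equation -/

theorem evol_potBurgersRHS (η : DiffFun) :
    evol η potBurgersRHS = Dx (Dx η) + 2 * coord (.z 1) * Dx η := by
  unfold potBurgersRHS
  rw [map_add, Derivation.leibniz_pow, evol_z, evol_z]
  simp only [Function.iterate_succ_apply', Function.iterate_zero_apply, smul_eq_mul, pow_one,
    Nat.add_one_sub_one]
  ring

/-- The invariance condition says that `D_t + (w_xx + w_x²) - P²` annihilates the characteristic.
This operator is `e^{-w} (D_t - D_x²) e^w`, the heat operator in the variable `e^w`. -/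
theorem isSymmetry_potBurgersRHS_iff {η : DiffFun} : IsSymmetry potBurgersRHS η ↔
    Dt potBurgersRHS η + potBurgersRHS * η = opP (opP η) := by
  rw [IsSymmetry, evol_potBurgersRHS, opP_apply, opP_apply, map_add, Derivation.leibniz, Dx_z]
  unfold potBurgersRHS
  simp only [smul_eq_mul]
  constructor
  · intro h
    rw [h]
    ring
  · intro h
    linear_combination h

/-- `P` commutes with `D_t + (w_xx + w_x²)`, since both are total derivatives twisted by `e^w`. -/
theorem isSymmetry_opP {η : DiffFun} (h : IsSymmetry potBurgersRHS η) :
    IsSymmetry potBurgersRHS (opP η) := by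
  rw [isSymmetry_potBurgersRHS_iff] at h ⊢
  rw [← h, opP_apply η, map_add, Derivation.leibniz, Dt_z, opP_apply, map_add, Derivation.leibniz,
    Dx_Dt]
  simp only [smul_eq_mul, Function.iterate_succ_apply', Function.iterate_zero_apply]
  ring

theorem opP_opG_apply (F : DiffFun) :
    opP (opG F) = opG (opP F) + (1 / 2 : ℝ) • F :=
  congrArg (fun T => T F) opP_opG

/-- `G` commutes with `D_t + (w_xx + w_x²) - P²`: its commutators with `D_t + (w_xx + w_x²)` and
with `P²` coincide. -/
theorem isSymmetry_opG {η : DiffFun} (h : IsSymmetry potBurgersRHS η) :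
    IsSymmetry potBurgersRHS (opG η) := by
  have hP := isSymmetry_opP h
  rw [isSymmetry_potBurgersRHS_iff] at h hP ⊢
  have e : opP (opP (opG η)) =
      opG (opP (opP η)) + opP η := by
    rw [opP_opG_apply, map_add, opP_opG_apply, LinearMap.map_smul, add_assoc, ← add_smul,
      add_halves, one_smul]
  rw [e, opG_apply (opP (opP η)), ← hP, ← h, opG_apply, map_add,
    Derivation.leibniz, Derivation.map_smul, Derivation.leibniz, Dt_t, Dt_x]
  simp only [smul_eq_mul, Algebra.smul_def]
  ring

theorem isSymmetry_opG_pow_opP_pow (k l : ℕ) :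
    IsSymmetry potBurgersRHS ((opG ^ k * opP ^ l) 1) := by
  rw [Module.End.mul_apply]
  have h1 : IsSymmetry potBurgersRHS 1 := by
    rw [isSymmetry_potBurgersRHS_iff, opP_apply, opP_apply]
    simp [potBurgersRHS, Dx_z, pow_two]
  have hP : IsSymmetry potBurgersRHS ((opP ^ l) 1) := by
    induction l with
    | zero => exact h1
    | succ l ih => rw [pow_succ', Module.End.mul_apply]; exact isSymmetry_opP ih
  induction k with
  | zero => exact hP
  | succ k ih => rw [pow_succ', Module.End.mul_apply]; exact isSymmetry_opG ih

theorem Lambda2_le_Sigma2 : Lambda2 ≤ Sigma2 := by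
  have h : Submodule.span ℝ {X | ∃ k l : ℕ, X = Qtilde k l} ≤ Sigma2.toSubmodule := by
    refine Submodule.span_le.2 ?_
    rintro _ ⟨k, l, rfl⟩
    exact ⟨_, isSymmetry_opG_pow_opP_pow k l, rfl⟩
  exact h

/-! ### Leading coefficients of the elements of the essential algebra -/

/-- The operator `e^{-w} ∂_{w_j} e^w`. These operators, unlike `∂_{w_j}`, satisfy one commutation
relation with `P = e^{-w} D_x e^w` for all `j`. -/
noncomputable def twistedPd (j : ℕ) (F : DiffFun) : DiffFun :=
  pd (.z j) F + if j = 0 then F else 0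

theorem twistedPd_succ (j : ℕ) (F : DiffFun) : twistedPd (j + 1) F = pd (.z (j + 1)) F := by
  simp [twistedPd]

theorem twistedPd_succ_opP (j : ℕ) (F : DiffFun) :
    twistedPd (j + 1) (opP F) = opP (twistedPd (j + 1) F) + twistedPd j F := by
  rw [twistedPd_succ, twistedPd_succ, opP_apply, opP_apply, map_add, pd_z_succ_Dx,
    Derivation.leibniz, pd_coord, twistedPd]
  rcases j with _ | j
  · simp only [if_true, smul_eq_mul]
    ring
  · rw [if_neg (by simp), if_neg (by simp)]
    simp only [smul_eq_mul]
    ring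

theorem twistedPd_succ_opG (j : ℕ) (F : DiffFun) :
    twistedPd (j + 1) (opG F) = opG (twistedPd (j + 1) F) + coord .t * twistedPd j F := by
  rw [opG_apply, opG_apply, twistedPd_succ, map_add, Derivation.map_smul, Derivation.leibniz,
    Derivation.leibniz, pd_coord, pd_coord, ← twistedPd_succ, twistedPd_succ_opP, ← twistedPd_succ]
  simp only [reduceCtorEq, if_false, smul_eq_mul, mul_zero, add_zero]
  ring

/-- The leading term of `G^k P^l 1` is `t^k w_{k+l}`. -/
theorem twistedPd_opG_pow_opP_pow (k l : ℕ) :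
    twistedPd (k + l) ((opG ^ k * opP ^ l) 1) = coord .t ^ k ∧
      ∀ j, k + l < j → twistedPd j ((opG ^ k * opP ^ l) 1) = 0 := by
  have hP : twistedPd l ((opP ^ l) 1) = 1 ∧ ∀ j, l < j → twistedPd j ((opP ^ l) 1) = 0 := by
    induction l with
    | zero =>
      refine ⟨by simp [twistedPd], fun j hj => ?_⟩
      simp [twistedPd, hj.ne']
    | succ l ih =>
      rw [pow_succ', Module.End.mul_apply]
      refine ⟨?_, ?_⟩
      · rw [twistedPd_succ_opP, ih.1, ih.2 _ (Nat.lt_succ_self l), map_zero, zero_add]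
      · rintro (_ | j) hj
        · omega
        · rw [twistedPd_succ_opP, ih.2 _ (by omega), ih.2 _ (by omega), map_zero, zero_add]
  rw [Module.End.mul_apply]
  induction k with
  | zero => simpa using hP
  | succ k ih =>
    rw [pow_succ' opG, Module.End.mul_apply, Nat.add_right_comm]
    refine ⟨?_, ?_⟩
    · rw [twistedPd_succ_opG, ih.1, ih.2 _ (Nat.lt_succ_self _), map_zero, zero_add, pow_succ']
    · rintro (_ | j) hj
      · omega
      · rw [twistedPd_succ_opG, ih.2 _ (by omega), ih.2 _ (by omega), map_zero, zero_add, mul_zero]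

theorem pd_z_zero_opP {F : DiffFun} (h : pd (.z 0) F = 0) : pd (.z 0) (opP F) = 0 := by
  rw [opP_apply, map_add, pd_z_zero_Dx, Derivation.leibniz, pd_coord, h]
  simp

theorem pd_z_zero_opG {F : DiffFun} (h : pd (.z 0) F = 0) : pd (.z 0) (opG F) = 0 := by
  rw [opG_apply, map_add, Derivation.map_smul, Derivation.leibniz, Derivation.leibniz, pd_coord,
    pd_coord, h, pd_z_zero_opP h]
  simp

theorem pd_z_zero_opG_pow_opP_pow (k l : ℕ) : pd (.z 0) ((opG ^ k * opP ^ l) 1) = 0 := by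
  rw [Module.End.mul_apply]
  have hP : pd (.z 0) ((opP ^ l) 1) = 0 := by
    induction l with
    | zero => simp
    | succ l ih => rw [pow_succ', Module.End.mul_apply]; exact pd_z_zero_opP ih
  induction k with
  | zero => exact hP
  | succ k ih => rw [pow_succ', Module.End.mul_apply]; exact pd_z_zero_opG ih

/-! ### The characteristics of the induced symmetries of the Burgers equation -/

/-- The characteristics of the elements of the essential algebra. -/
noncomputable def essentialChar : Submodule ℝ DiffFun :=
  Submodule.span ℝ {η | ∃ k l : ℕ, η = (opG ^ k * opP ^ l) 1}

theorem mem_Lambda2_iff {X : Derivation ℝ DiffFun DiffFun} :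
    X ∈ Lambda2 ↔ ∃ η ∈ essentialChar, X = evol η := by
  let E : DiffFun →ₗ[ℝ] Derivation ℝ DiffFun DiffFun :=
    { toFun := evol, map_add' := evol_add, map_smul' := evol_smul }
  have h : Submodule.span ℝ {X | ∃ k l : ℕ, X = Qtilde k l} = essentialChar.map E := by
    rw [essentialChar, Submodule.map_span]
    congr 1
    ext X
    constructor
    · rintro ⟨k, l, rfl⟩
      exact ⟨_, ⟨k, l, rfl⟩, rfl⟩
    · rintro ⟨_, ⟨k, l, rfl⟩, rfl⟩
      exact ⟨k, l, rfl⟩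
  change X ∈ Submodule.span ℝ _ ↔ _
  rw [h, Submodule.mem_map]
  exact exists_congr fun η => and_congr_right fun _ => eq_comm

theorem pd_z_zero_of_mem_essentialChar {η : DiffFun} (h : η ∈ essentialChar) :
    pd (.z 0) η = 0 := by
  have : essentialChar ≤ LinearMap.ker (pd (.z 0)).toLinearMap := by
    refine Submodule.span_le.2 ?_
    rintro _ ⟨k, l, rfl⟩
    exact pd_z_zero_opG_pow_opP_pow k l
  exact this h

theorem isSymmetry_of_mem_essentialChar {η : DiffFun} (h : η ∈ essentialChar) :
    IsSymmetry potBurgersRHS η := by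
  obtain ⟨χ, hχ, e⟩ := Lambda2_le_Sigma2 (mem_Lambda2_iff.2 ⟨η, h, rfl⟩)
  have := congrArg (fun X => X (coord (.z 0))) e
  simp only [evol_coord_z_zero] at this
  rwa [this]

/-- The characteristic of the vector field on the jet space of `v` that `η ∂_w` induces. It is
meaningful for `η` that do not involve `w` itself, as `unsubstHom` sets `w = 0`. -/
noncomputable def inducedChar : DiffFun →ₗ[ℝ] DiffFun :=
  (-2 : ℝ) • (unsubstHom.toLinearMap ∘ₗ Dx.toLinearMap)

theorem substHom_inducedChar {η : DiffFun} (h : pd (.z 0) η = 0) :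
    substHom (inducedChar η) = (-2 : ℝ) • Dx η := by
  change substHom ((-2 : ℝ) • unsubstHom (Dx η)) = _
  rw [map_smul, substHom_unsubstHom]
  rw [pd_z_zero_Dx, h, map_zero]

theorem isSymmetry_inducedChar {η : DiffFun} (h : η ∈ essentialChar) :
    IsSymmetry burgersRHS (inducedChar η) :=
  (isSymmetry_of_mem_essentialChar h).of_substHom
    (substHom_inducedChar (pd_z_zero_of_mem_essentialChar h)).symm

/-- Differentiation with respect to `v_j` of the characteristic induced by `η ∂_w`. -/
theorem substHom_pd_inducedChar {η : DiffFun} (h : pd (.z 0) η = 0) (j : ℕ) :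
    substHom (pd (.z j) (inducedChar η)) = Dx (pd (.z (j + 1)) η) + pd (.z j) η := by
  have e := pd_z_succ_substHom j (inducedChar η)
  rw [substHom_inducedChar h, Derivation.map_smul, pd_z_succ_Dx] at e
  exact (smul_right_injective DiffFun (by norm_num : (-2 : ℝ) ≠ 0) e).symm

/-- Every polynomial in `t` of degree at most `n + 1` is the leading coefficient of an induced
characteristic of order at most `n + 1`. -/
theorem exists_inducedChar_leading {n : ℕ} {a : DiffFun} (ha : a ∈ timePoly (n + 1)) :
    ∃ η ∈ essentialChar, pd (.z (n + 1)) (inducedChar η) = a ∧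
      OrderLE (n + 1) (inducedChar η) := by
  refine Submodule.span_induction (p := fun a _ => ∃ η ∈ essentialChar,
    pd (.z (n + 1)) (inducedChar η) = a ∧ OrderLE (n + 1) (inducedChar η)) ?_ ?_ ?_ ?_ ha
  · rintro _ ⟨k, hk, rfl⟩
    obtain ⟨l, hl⟩ := Nat.exists_eq_add_of_le (Set.mem_Iic.1 hk)
    have h0 := pd_z_zero_opG_pow_opP_pow k l
    have ht := twistedPd_opG_pow_opP_pow k l
    rw [← hl] at ht
    refine ⟨(opG ^ k * opP ^ l) 1, Submodule.subset_span ⟨k, l, rfl⟩, ?_, fun j hj => ?_⟩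
    · refine substHom_injective ?_
      rw [substHom_pd_inducedChar h0, ← twistedPd_succ, ← twistedPd_succ, ht.1,
        ht.2 _ (Nat.lt_succ_self _), map_zero, zero_add, map_pow, substHom_t]
    · refine substHom_injective ?_
      obtain ⟨j, rfl⟩ : ∃ i, j = i + 1 := ⟨j - 1, by omega⟩
      rw [substHom_pd_inducedChar h0, ← twistedPd_succ, ← twistedPd_succ, ht.2 _ hj,
        ht.2 _ (by omega), map_zero, zero_add, map_zero]
  · exact ⟨0, zero_mem _, by simp, fun j _ => by simp⟩
  · rintro _ _ _ _ ⟨η, h1, h2, h3⟩ ⟨χ, g1, g2, g3⟩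
    exact ⟨η + χ, add_mem h1 g1, by rw [map_add, map_add, h2, g2],
      fun j hj => by rw [map_add, map_add, h3 j hj, g3 j hj, add_zero]⟩
  · rintro r _ _ ⟨η, h1, h2, h3⟩
    exact ⟨r • η, Submodule.smul_mem _ r h1, by rw [map_smul, Derivation.map_smul, h2],
      fun j hj => by rw [map_smul, Derivation.map_smul, h3 j hj, smul_zero]⟩


/-! ### Symmetries of the Burgers equation -/

theorem isSymmetry_burgersRHS_iff {F : DiffFun} : IsSymmetry burgersRHS F ↔
    Dt burgersRHS F = Dx (Dx F) - coord (.z 0) * Dx F - coord (.z 1) * F := by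
  rw [IsSymmetry]
  have : evol F burgersRHS = Dx (Dx F) - coord (.z 0) * Dx F - coord (.z 1) * F := by
    unfold burgersRHS
    rw [map_sub, Derivation.leibniz, evol_z, evol_z, evol_z]
    simp only [Function.iterate_succ_apply', Function.iterate_zero_apply, smul_eq_mul]
    ring
  rw [this]

/-- The derivatives of `D_x^k (v_2 - v v_1)` with respect to the three highest jet coordinates that
it involves. -/
theorem pd_Dx_iterate_burgersRHS (k : ℕ) :
    (∀ j, k + 2 < j → pd (.z j) (Dx^[k] burgersRHS) = 0) ∧
    pd (.z (k + 2)) (Dx^[k] burgersRHS) = 1 ∧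
    pd (.z (k + 1)) (Dx^[k] burgersRHS) = -coord (.z 0) ∧
    pd (.z k) (Dx^[k] burgersRHS) = -((k : DiffFun) + 1) * coord (.z 1) := by
  induction k with
  | zero =>
    simp only [Function.iterate_zero_apply, burgersRHS, map_sub, Derivation.leibniz, pd_coord]
    refine ⟨fun j hj => ?_, by simp, by simp, by simp; ring⟩
    have h0 : j ≠ 0 := by omega
    have h1 : j ≠ 1 := by omega
    have h2 : j ≠ 2 := by omega
    simp [h0, h1, h2]
  | succ k ih =>
    obtain ⟨h1, h2, h3, h4⟩ := ih
    simp only [Function.iterate_succ_apply']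
    refine ⟨fun j hj => ?_, ?_, ?_, ?_⟩
    · obtain ⟨j, rfl⟩ : ∃ i, j = i + 1 := ⟨j - 1, by omega⟩
      rw [pd_z_succ_Dx, h1 _ (by omega), h1 _ (by omega), map_zero, add_zero]
    · rw [show k + 1 + 2 = (k + 2) + 1 from rfl, pd_z_succ_Dx, h1 _ (by omega), h2, map_zero,
        zero_add]
    · rw [pd_z_succ_Dx, h2, h3, Derivation.map_one_eq_zero, zero_add]
    · rw [pd_z_succ_Dx, h3, h4, map_neg, Dx_z]
      push_cast
      ring

/-- The commutator of `∂_{v_i}` and `D_t`, reduced to a finite sum. -/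
theorem pd_Dt_burgersRHS (i : ℕ) (F : DiffFun) (S : Finset ℕ)
    (hS : ∀ k ∉ S, pd (.z i) (Dx^[k] burgersRHS) = 0 ∨ pd (.z k) F = 0) :
    pd (.z i) (Dt burgersRHS F) = Dt burgersRHS (pd (.z i) F) +
      ∑ k ∈ S, pd (.z i) (Dx^[k] burgersRHS) * pd (.z k) F := by
  refine (pd_vf _ _ _).trans (congrArg₂ _ rfl ?_)
  have hinj : Function.Injective Coord.z := fun a b h => by injection h
  rw [vf_eq_sum_of_mul _ (S.map ⟨Coord.z, hinj⟩), Finset.sum_map]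
  · rfl
  · rintro (_ | _ | k) hk
    · simp
    · simp
    · rcases hS k (by simpa using hk) with h | h
      · exact mul_eq_zero_of_left h _
      · exact mul_eq_zero_of_right _ h

/-- The coefficient of `v_1` in `D_t F`, for `F` of order zero. -/
theorem pd_Dt_z_zero {F : DiffFun} (hF : OrderLE 0 F) :
    pd (.z 1) (Dt burgersRHS F) = -coord (.z 0) * pd (.z 0) F := by
  rw [pd_Dt_burgersRHS 1 F {0} fun k hk => Or.inr (hF k (Nat.pos_of_ne_zero (by simpa using hk))),
    hF 1 one_pos, map_zero, zero_add, Finset.sum_singleton, (pd_Dx_iterate_burgersRHS 0).2.2.1]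

/-- There is no nonzero symmetry of the Burgers equation that involves `t`, `x` and `v` only. -/
theorem eq_zero_of_isSymmetry_of_orderLE_zero {F : DiffFun} (hF : OrderLE 0 F)
    (h : IsSymmetry burgersRHS F) : F = 0 := by
  have h1 : ∀ {G : DiffFun}, OrderLE 0 G → pd (.z 1) (Dx G) = pd (.z 0) G := fun hG => by
    rw [pd_z_succ_Dx, hG 1 one_pos, map_zero, zero_add]
  have e := congrArg (pd (.z 1)) (isSymmetry_burgersRHS_iff.1 h)
  rw [pd_Dt_z_zero hF, map_sub, map_sub, pd_z_succ_Dx, h1 hF, pd_z_zero_Dx, Derivation.leibniz,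
    Derivation.leibniz, h1 hF, pd_coord, pd_coord, hF 1 one_pos] at e
  simp only [smul_eq_mul, Coord.z.injEq, one_ne_zero, if_false, if_true, mul_zero,
    add_zero, mul_one, zero_add] at e
  -- The coefficient of `v_1` in the invariance condition.
  have e1 : F = 2 * Dx (pd (.z 0) F) := by linear_combination e
  have two : ∀ {i : Coord} (G : DiffFun), pd i (2 * G) = 2 * pd i G := fun {i} G => by
    rw [two_mul, map_add, two_mul]
  have e2 : 2 * pd (.z 0) (pd (.z 0) F) = 0 := by
    rw [← h1 (hF.pd _), ← two, ← e1, hF 1 one_pos]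
  have e3 : pd (.z 0) F = 0 := by
    calc pd (.z 0) F = pd (.z 0) (2 * Dx (pd (.z 0) F)) := by rw [← e1]
      _ = Dx (2 * pd (.z 0) (pd (.z 0) F)) := by
        rw [two, pd_z_zero_Dx, two_mul, two_mul, map_add]
      _ = 0 := by rw [e2, map_zero]
  rw [e1, e3, map_zero, mul_zero]

/-- The leading coefficient of a symmetry of the Burgers equation is a function of `t`: the
coefficient of `v_{n+2}` in the invariance condition is twice its total derivative. -/
theorem timeOnly_leading_of_isSymmetry {n : ℕ} {F : DiffFun} (hF : OrderLE (n + 1) F)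
    (h : IsSymmetry burgersRHS F) : TimeOnly (pd (.z (n + 1)) F) := by
  refine timeOnly_of_Dx_eq_zero ?_
  -- Only `k = n` and `k = n + 1` contribute to the commutator of `∂/∂v_{n+2}` and `D_t`.
  have e := congrArg (pd (.z (n + 2))) (isSymmetry_burgersRHS_iff.1 h)
  have h2 : pd (.z (n + 2)) F = 0 := hF _ (by omega)
  rw [pd_Dt_burgersRHS (n + 2) F {n, n + 1}, Finset.sum_pair (by omega), h2,
    (pd_Dx_iterate_burgersRHS n).2.1, (pd_Dx_iterate_burgersRHS (n + 1)).2.2.1, map_sub, map_sub,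
    pd_z_succ_Dx, pd_z_succ_Dx, pd_z_succ_Dx, Derivation.leibniz, Derivation.leibniz, pd_z_succ_Dx,
    pd_coord, pd_coord, h2] at e
  · simp only [smul_eq_mul, Coord.z.injEq, if_false, mul_zero, map_zero, zero_add,
      show n + 2 ≠ 0 by omega, show n + 2 ≠ 1 by omega] at e
    have e2 : (2 : ℝ) • Dx (pd (.z (n + 1)) F) = 0 := by
      rw [two_smul]
      linear_combination -e
    exact (smul_eq_zero.1 e2).resolve_left two_ne_zero
  · intro k hk
    simp only [Finset.mem_insert, Finset.mem_singleton, not_or] at hk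
    rcases lt_or_ge k n with hlt | hge
    · exact Or.inl ((pd_Dx_iterate_burgersRHS k).1 _ (by omega))
    · exact Or.inr (hF _ (by omega))

/-- `a v_1 - a'` is a symmetry only if `a'' = 0`. -/
theorem mem_timePoly_one_of_isSymmetry {a : DiffFun} (ha : TimeOnly a)
    (h : IsSymmetry burgersRHS (coord (.z 1) * a - pd .t a)) : a ∈ timePoly 1 := by
  have h2 : pd .t (pd .t a) = 0 := by
    rw [isSymmetry_burgersRHS_iff] at h
    have hL : Dx burgersRHS =
        coord (.z 3) - coord (.z 1) * coord (.z 1) - coord (.z 0) * coord (.z 2) := by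
      unfold burgersRHS
      rw [map_sub, Derivation.leibniz, Dx_z, Dx_z, Dx_z]
      simp only [smul_eq_mul]
      ring
    simp only [map_sub, Derivation.leibniz, smul_eq_mul, Dx_z, Dt_z, ha.Dt_eq,
      ha.pd_t.Dt_eq, ha.Dx_eq_zero, ha.pd_t.Dx_eq_zero, Function.iterate_one, hL, mul_zero,
      zero_add, sub_zero] at h
    linear_combination -h
  obtain ⟨r, hr⟩ := eq_algebraMap_of_pd_eq_zero (F := pd .t a) fun i => by
    by_cases hi : i = .t
    · rw [hi, h2]
    · exact ha.pd_t i hi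
  refine mem_timePoly_of_pd ha ?_
  rw [hr, Algebra.algebraMap_eq_smul_one]
  exact Submodule.smul_mem _ _ (one_mem_timePoly _)

/-- Symmetries of order at most one: `F = a v_1 - a'` with `a'' = 0`. -/
theorem leading_mem_timePoly_one {F : DiffFun} (hF : OrderLE 1 F)
    (h : IsSymmetry burgersRHS F) : pd (.z 1) F ∈ timePoly 1 := by
  have ha := timeOnly_leading_of_isSymmetry (n := 0) hF h
  rw [zero_add] at ha
  obtain ⟨a, rfl⟩ : ∃ a, a = pd (.z 1) F := ⟨_, rfl⟩
  have two : ∀ {i : Coord} (G : DiffFun), pd i (2 * G) = 2 * pd i G := fun {i} G => by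
    rw [two_mul, map_add, two_mul]
  have e := congrArg (pd (.z 1)) (isSymmetry_burgersRHS_iff.1 h)
  rw [pd_Dt_burgersRHS 1 F {0, 1}, Finset.sum_pair (by omega),
    (pd_Dx_iterate_burgersRHS 0).2.2.1, (pd_Dx_iterate_burgersRHS 1).2.2.2, map_sub, map_sub,
    pd_z_succ_Dx, pd_z_succ_Dx, pd_z_zero_Dx, Derivation.leibniz, Derivation.leibniz, pd_z_succ_Dx,
    pd_coord, pd_coord, ha.Dx_eq_zero, ha.Dt_eq, zero_add] at e
  · simp only [smul_eq_mul, Coord.z.injEq, if_false, if_true, mul_zero, one_ne_zero, add_zero,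
      mul_one, Nat.cast_one] at e
    -- The coefficient of `v_1` in the invariance condition.
    have e1 : F = 2 * Dx (pd (.z 0) F) + coord (.z 1) * pd (.z 1) F - pd .t (pd (.z 1) F) := by
      linear_combination e
    have ez : ∀ j, pd (.z j) (pd (.z 1) F) = 0 := fun j => ha _ (by simp)
    have ezt : ∀ j, pd (.z j) (pd .t (pd (.z 1) F)) = 0 := fun j => ha.pd_t _ (by simp)
    have e2 : 2 * pd (.z 0) (pd (.z 0) F) = 0 := by
      have := congrArg (pd (.z 1)) e1
      rw [map_sub, map_add, two, pd_z_succ_Dx, Derivation.leibniz, ez, ezt, pd_coord,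
        pd_comm (.z 1), ez] at this
      simp only [smul_eq_mul, if_true, mul_zero, map_zero, zero_add, mul_one,
        sub_zero] at this
      linear_combination -this
    have e3 : pd (.z 0) F = 0 := by
      have := congrArg (pd (.z 0)) e1
      rw [map_sub, map_add, two, pd_z_zero_Dx, Derivation.leibniz, ez, ezt, pd_coord] at this
      simp only [smul_eq_mul, Coord.z.injEq, if_false, mul_zero, zero_ne_one,
        add_zero, sub_zero] at this
      rw [this, two_mul, ← map_add, ← two_mul, e2, map_zero]
    rw [e3, map_zero, mul_zero, zero_add] at e1
    exact mem_timePoly_one_of_isSymmetry ha (e1 ▸ h)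
  · intro k hk
    simp only [Finset.mem_insert, Finset.mem_singleton, not_or] at hk
    exact Or.inr (hF _ (by omega))

/-- The Burgers equation does not involve `x` explicitly, so `∂_x` acts on its symmetries. -/
theorem isSymmetry_pd_x {F : DiffFun} (h : IsSymmetry burgersRHS F) :
    IsSymmetry burgersRHS (pd .x F) := by
  have hL : ∀ k, pd .x (Dx^[k] burgersRHS) = 0 := by
    intro k
    induction k with
    | zero => simp [burgersRHS, pd_coord]
    | succ k ih => rw [Function.iterate_succ_apply', pd_Dx_of_ne (by simp), ih, map_zero]
  have hDt : pd .x (Dt burgersRHS F) = Dt burgersRHS (pd .x F) := by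
    refine (pd_vf _ _ _).trans (add_eq_left.2 (DFunLike.congr_fun (vf_zero_of ?_) F))
    rintro (_ | _ | k)
    · exact Derivation.map_one_eq_zero _
    · exact map_zero _
    · exact hL k
  rw [isSymmetry_burgersRHS_iff] at h ⊢
  rw [← hDt, h, map_sub, map_sub, Derivation.leibniz, Derivation.leibniz, pd_coord, pd_coord,
    pd_Dx_of_ne (by simp), pd_Dx_of_ne (by simp)]
  simp

/-- If `a = a(t)` is the leading coefficient of a symmetry `F` of order `n + 2`, then that of
`∂_x F` is `a' / 2`. -/
theorem pd_t_leading_of_isSymmetry {n : ℕ} {F : DiffFun} (hF : OrderLE (n + 2) F)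
    (h : IsSymmetry burgersRHS F) :
    pd .t (pd (.z (n + 2)) F) = (2 : ℝ) • pd (.z (n + 1)) (pd .x F) := by
  have ha := timeOnly_leading_of_isSymmetry (n := n + 1) hF h
  have e := congrArg (pd (.z (n + 2))) (isSymmetry_burgersRHS_iff.1 h)
  rw [pd_Dt_burgersRHS (n + 2) F {n, n + 1, n + 2}, Finset.sum_insert (by simp),
    Finset.sum_pair (by omega), (pd_Dx_iterate_burgersRHS n).2.1,
    (pd_Dx_iterate_burgersRHS (n + 1)).2.2.1, (pd_Dx_iterate_burgersRHS (n + 2)).2.2.2, map_sub,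
    map_sub, pd_z_succ_Dx, pd_z_succ_Dx, pd_z_succ_Dx, Derivation.leibniz, Derivation.leibniz,
    pd_z_succ_Dx, pd_coord, pd_coord, ha.Dt_eq, ha.Dx_eq_zero] at e
  · simp only [smul_eq_mul, Coord.z.injEq, if_false, mul_zero, add_zero, zero_add,
      show n + 2 ≠ 0 by omega, show n + 2 ≠ 1 by omega] at e
    -- The coefficient of `v_{n+2}` in the invariance condition is a total derivative, which is
    -- integrated in closed form.
    have e1 : Dx (2 * pd (.z (n + 1)) F - (coord .x * pd .t (pd (.z (n + 2)) F) -
        ((n + 2 : ℕ) : DiffFun) * (coord (.z 0) * pd (.z (n + 2)) F))) = 0 := by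
      rw [← nsmul_eq_mul, map_sub, map_sub, two_mul, map_add, map_nsmul, Derivation.leibniz,
        Derivation.leibniz, ha.pd_t.Dx_eq_zero, ha.Dx_eq_zero, Dx_x, Dx_z]
      simp only [smul_eq_mul, nsmul_eq_mul, mul_zero, mul_one, zero_add]
      linear_combination -e
    have e2 := timeOnly_of_Dx_eq_zero e1 .x (by simp)
    rw [← nsmul_eq_mul, map_sub, map_sub, two_mul, map_add, map_nsmul, Derivation.leibniz,
      Derivation.leibniz, ha.pd_t .x (by simp), ha .x (by simp), pd_coord, pd_coord,
      pd_comm .x (.z (n + 1))] at e2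
    simp only [smul_eq_mul, reduceCtorEq, if_true, if_false, mul_zero, mul_one, zero_add,
      smul_zero, sub_zero] at e2
    rw [two_smul]
    linear_combination -e2
  · intro k hk
    simp only [Finset.mem_insert, Finset.mem_singleton, not_or] at hk
    rcases lt_or_ge k n with hlt | hge
    · exact Or.inl ((pd_Dx_iterate_burgersRHS k).1 _ (by omega))
    · exact Or.inr (hF _ (by omega))

/-- The leading coefficient of a symmetry of order `n + 1` is a polynomial in `t` of degree at most
`n + 1`. -/
theorem leading_mem_timePoly (n : ℕ) : ∀ {F : DiffFun}, OrderLE (n + 1) F →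
    IsSymmetry burgersRHS F → pd (.z (n + 1)) F ∈ timePoly (n + 1) := by
  induction n with
  | zero => exact leading_mem_timePoly_one
  | succ n ih =>
    intro F hF h
    refine mem_timePoly_of_pd (timeOnly_leading_of_isSymmetry hF h) ?_
    rw [pd_t_leading_of_isSymmetry hF h]
    refine Submodule.smul_mem _ _ (ih (fun j hj => ?_) (isSymmetry_pd_x h))
    rcases eq_or_lt_of_le (Nat.succ_le_of_lt hj) with rfl | hj'
    · rw [pd_comm]
      exact timeOnly_leading_of_isSymmetry (n := n + 1) hF h .x (by simp)
    · exact hF.pd .x j hj'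

/-- Every symmetry of the Burgers equation is induced by an element of the essential algebra. -/
theorem exists_inducedChar_eq (n : ℕ) : ∀ {F : DiffFun}, OrderLE n F →
    IsSymmetry burgersRHS F → ∃ η ∈ essentialChar, inducedChar η = F := by
  induction n with
  | zero =>
    intro F hF h
    exact ⟨0, zero_mem _, by rw [map_zero, eq_zero_of_isSymmetry_of_orderLE_zero hF h]⟩
  | succ n ih =>
    intro F hF h
    obtain ⟨η, h1, h2, h3⟩ := exists_inducedChar_leading (leading_mem_timePoly n hF h)
    have h4 := isSymmetry_inducedChar h1
    have h5 : IsSymmetry burgersRHS (F - inducedChar η) := by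
      rw [isSymmetry_burgersRHS_iff] at h h4 ⊢
      simp only [map_sub, h, h4]
      ring
    have h6 : OrderLE n (F - inducedChar η) := by
      intro j hj
      rw [map_sub]
      rcases eq_or_lt_of_le (Nat.succ_le_of_lt hj) with rfl | hj'
      · rw [h2, sub_self]
      · rw [hF j hj', h3 j hj', sub_self]
    obtain ⟨χ, g1, g2⟩ := ih h6 h5
    exact ⟨χ + η, add_mem g1 h1, by rw [map_add, g2, sub_add_cancel]⟩


/-! ### The homomorphism induced by the substitution -/

/-- The vector field on the jet space of `v` that an element of the essential algebra induces. -/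
noncomputable def inducedVf (X : Derivation ℝ DiffFun DiffFun) : Derivation ℝ DiffFun DiffFun :=
  evol (inducedChar (X (coord (.z 0))))

theorem inducedVf_evol (η : DiffFun) : inducedVf (evol η) = evol (inducedChar η) := by
  rw [inducedVf, evol_coord_z_zero]

theorem inducedVf_mem_Sigma3 {X : Derivation ℝ DiffFun DiffFun} (h : X ∈ Lambda2) :
    inducedVf X ∈ Sigma3 := by
  obtain ⟨η, hη, rfl⟩ := mem_Lambda2_iff.1 h
  exact ⟨_, isSymmetry_inducedChar hη, inducedVf_evol η⟩

theorem apply_substHom_of_mem_Lambda2 {X : Derivation ℝ DiffFun DiffFun} (h : X ∈ Lambda2)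
    (F : DiffFun) : X (substHom F) = substHom (inducedVf X F) := by
  obtain ⟨η, hη, rfl⟩ := mem_Lambda2_iff.1 h
  rw [inducedVf_evol]
  exact evol_substHom (substHom_inducedChar (pd_z_zero_of_mem_essentialChar hη)).symm F

theorem inducedBy_iff {Q R : Derivation ℝ DiffFun DiffFun} :
    InducedBy Q R ↔ Q (substHom (coord (.z 0))) = substHom (R (coord (.z 0))) := by
  rw [substHom_z, Subtype.ext_iff, funext_iff]
  simp only [substHom_apply]
  rfl

/-- A symmetry of the Burgers equation is determined by its characteristic. -/
theorem ext_of_mem_Sigma3 {R R' : Derivation ℝ DiffFun DiffFun} (h : R ∈ Sigma3)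
    (h' : R' ∈ Sigma3) (e : R (coord (.z 0)) = R' (coord (.z 0))) : R = R' := by
  obtain ⟨ξ, -, rfl⟩ := h
  obtain ⟨ξ', -, rfl⟩ := h'
  rw [evol_coord_z_zero, evol_coord_z_zero] at e
  rw [e]

/-- The homomorphism from the essential algebra to the symmetry algebra of the Burgers equation
that the substitution `v = -2 w_x` induces. -/
noncomputable def inducedHom : Lambda2 →ₗ⁅ℝ⁆ Sigma3 where
  toFun X := ⟨inducedVf X, inducedVf_mem_Sigma3 X.2⟩
  map_add' X Y := Subtype.ext <| by
    change inducedVf (X + Y : Derivation ℝ DiffFun DiffFun) = inducedVf X + inducedVf Y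
    rw [inducedVf, Derivation.add_apply, map_add, evol_add]
    rfl
  map_smul' r X := Subtype.ext <| by
    change inducedVf (r • (X : Derivation ℝ DiffFun DiffFun)) = r • inducedVf X
    rw [inducedVf, Derivation.smul_apply, map_smul, evol_smul]
    rfl
  map_lie' := by
    intro X Y
    refine Subtype.ext ?_
    have hX := inducedVf_mem_Sigma3 X.2
    have hY := inducedVf_mem_Sigma3 Y.2
    change inducedVf ⁅(X : Derivation ℝ DiffFun DiffFun), (Y : Derivation ℝ DiffFun DiffFun)⁆ =
      ⁅inducedVf X, inducedVf Y⁆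
    have hXY := Lambda2.lie_mem X.2 Y.2
    refine ext_of_mem_Sigma3 (inducedVf_mem_Sigma3 hXY) (Sigma3.lie_mem hX hY)
      (substHom_injective ?_)
    rw [← apply_substHom_of_mem_Lambda2 hXY, Derivation.commutator_apply,
      Derivation.commutator_apply, map_sub, apply_substHom_of_mem_Lambda2 X.2,
      apply_substHom_of_mem_Lambda2 Y.2, apply_substHom_of_mem_Lambda2 X.2,
      apply_substHom_of_mem_Lambda2 Y.2]

theorem inducedHom_eq_iff (Q : Lambda2) (R : Sigma3) : inducedHom Q = R ↔ InducedBy Q R := by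
  rw [inducedBy_iff, apply_substHom_of_mem_Lambda2 Q.2, substHom_injective.eq_iff]
  refine ⟨fun h => h ▸ rfl, fun h => Subtype.ext ?_⟩
  exact ext_of_mem_Sigma3 (inducedVf_mem_Sigma3 Q.2) R.2 h

theorem inducedHom_surjective : Function.Surjective inducedHom := by
  rintro ⟨_, ξ, hξ, rfl⟩
  obtain ⟨n, hn⟩ := exists_orderLE ξ
  obtain ⟨η, hη, e⟩ := exists_inducedChar_eq n hn hξ
  refine ⟨⟨evol η, mem_Lambda2_iff.2 ⟨η, hη, rfl⟩⟩, Subtype.ext ?_⟩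
  change inducedVf (evol η) = _
  rw [inducedVf_evol, e]

/-- The characteristics in the kernel are functions of `t` alone, and the potential Burgers
equation forces them to be constant. -/
theorem eq_smul_one_of_inducedChar_eq_zero {η : DiffFun} (hη : η ∈ essentialChar)
    (h : inducedChar η = 0) : ∃ r : ℝ, η = r • 1 := by
  have h1 : Dx η = 0 := by
    have e := substHom_inducedChar (pd_z_zero_of_mem_essentialChar hη)
    rw [h, map_zero] at e
    exact (smul_eq_zero.1 e.symm).resolve_left (by norm_num)
  have h2 := timeOnly_of_Dx_eq_zero h1
  have h3 := isSymmetry_of_mem_essentialChar hη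
  rw [IsSymmetry, evol_potBurgersRHS, h1, map_zero, mul_zero, add_zero, h2.Dt_eq] at h3
  obtain ⟨r, hr⟩ := eq_algebraMap_of_pd_eq_zero (F := η) fun i => by
    by_cases hi : i = .t
    · rw [hi, h3]
    · exact h2 i hi
  exact ⟨r, by rw [hr, Algebra.algebraMap_eq_smul_one]⟩

theorem ker_inducedHom : LinearMap.ker (inducedHom : Lambda2 →ₗ[ℝ] Sigma3) =
    Submodule.span ℝ {⟨partialW, partialW_mem⟩} := by
  ext ⟨X, hX⟩
  rw [LinearMap.mem_ker, Submodule.mem_span_singleton]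
  obtain ⟨η, hη, rfl⟩ := mem_Lambda2_iff.1 hX
  constructor
  · intro h
    have h0 : inducedVf (evol η) = 0 := congrArg Subtype.val h
    have h1 : inducedChar η = 0 := by
      rw [← evol_coord_z_zero (inducedChar η), ← inducedVf_evol, h0, Derivation.zero_apply]
    obtain ⟨r, rfl⟩ := eq_smul_one_of_inducedChar_eq_zero hη h1
    exact ⟨r, Subtype.ext (evol_smul r 1).symm⟩
  · rintro ⟨r, hr⟩
    have hr' : r • evol 1 = evol η := congrArg Subtype.val hr
    refine Subtype.ext ?_
    change inducedVf (evol η) = 0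
    rw [← hr', ← evol_smul, inducedVf_evol, map_smul]
    have : inducedChar 1 = 0 := by simp [inducedChar]
    rw [this, smul_zero, evol_zero]

end BurgersSym

theorem mainTheorem3 :
    BurgersSym.Lambda2 ≤ BurgersSym.Sigma2 ∧
    ∃ φ : BurgersSym.Lambda2 →ₗ⁅ℝ⁆ BurgersSym.Sigma3,
      (∀ (Q : BurgersSym.Lambda2) (R : BurgersSym.Sigma3),
        φ Q = R ↔ BurgersSym.InducedBy Q R) ∧
      Function.Surjective φ ∧
      LinearMap.ker (φ : BurgersSym.Lambda2 →ₗ[ℝ] BurgersSym.Sigma3) =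
        Submodule.span ℝ {⟨BurgersSym.partialW, BurgersSym.partialW_mem⟩} :=
  ⟨BurgersSym.Lambda2_le_Sigma2, BurgersSym.inducedHom, BurgersSym.inducedHom_eq_iff,
    BurgersSym.inducedHom_surjective, BurgersSym.ker_inducedHom⟩
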